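/- Let $p$ be a prime, $q=p^k$ with $k\ge 1$, and let $\pi=\zeta\sqrt q\in\mathbb{C}$, where $\zeta$ is a root of unity and $\sqrt q>0$. Let $\mathcal{O}$ be the ring of integers of $\mathbb{Q}(\pi)$, let $R$ be an order in $\mathbb{Q}(\pi)$ containing $\mathbb{Z}[\pi]$, and let $l\neq p$ be a prime. Write $R_l$ and $\mathcal{O}_l$ for the $l$-adic completions of $R$ and $\mathcal{O}$. Let $M$ be a finitely generated $R_l$-module that is torsion-free (that is, $\alpha m\ne 0$ for every non-zerodivisor $\alpha\in R_l$ and every nonzero $m\in M$) and of rank $e$ (that is, $M\otimes_{\mathbb{Z}_l}\mathbb{Q}_l$ is free of rank $e$ over $R_l\otimes_{\mathbb{Z}_l}\mathbb{Q}_l$). Unless $l=2$, $q$ is not a square and $\pi=\pm\sqrt{\left(\frac{-1}{p}\right)q}$, there is an isomorphism of $R_l$-modules $$M/(\pi-1)M\;\cong\;\bigl(R_l/(\pi-1)R_l\bigr)^e .$$ In the exceptional case $l=2$, $q$ not a square and $\pi=\pm\sqrt{\left(\frac{-1}{p}\right)q}$, there are non-negative integers $a,b$ with $a+b=e$ and an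 isomorphism of $R_2$-modules $$M/(\pi-1)M\;\cong\;\bigl(R_2/(\pi-1)R_2\bigr)^a\times\bigl(\mathcal{O}_2/(\pi-1)\mathcal{O}_2\bigr)^b .$$ Here $\left(\frac{-1}{p}\right)$ is the Jacobi symbol. -/

import Mathlib

open scoped IntermediateField

/-- `α` is a supersingular `q`-number: a root of unity times the positive square root of `q`. -/
def IsSupersingularNumber (q : ℕ) (α : ℂ) : Prop :=
  ∃ (ζ : ℂ) (m : ℕ), 0 < m ∧ ζ ^ m = 1 ∧ α = ζ * (Real.sqrt (q : ℝ) : ℂ)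

/-- `R` is an order in the number field `L`: a subring that is finitely generated as a `ℤ`-module
(it is then free, being torsion-free) and spans `L` over `ℚ`. -/
structure IsOrder {L : Type*} [Field L] [Algebra ℚ L] (R : Subalgebra ℤ L) : Prop where
  finite : Module.Finite ℤ R
  span_eq_top : Submodule.span ℚ (R : Set L) = ⊤

/-- The ring of integers of `L` (the elements integral over `ℤ`), regarded as a module over an
order `R` of `L`. -/
def integersOver {L : Type*} [Field L] [Algebra ℚ L] (R : Subalgebra ℤ L) (hR : IsOrder R) :
    Submodule R L where
  carrier := {x | IsIntegral ℤ x}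
  add_mem' := fun ha hb => IsIntegral.add ha hb
  zero_mem' := isIntegral_zero
  smul_mem' := by
    intro c x hx
    have := hR.finite
    have hc : IsIntegral ℤ (c : L) := (IsIntegral.of_finite ℤ c).map R.val
    exact hc.mul hx

instance {L : Type*} [Field L] [Algebra ℚ L] (R : Subalgebra ℤ L) (hR : IsOrder R) :
    Module R (integersOver R hR) :=
  Submodule.module _

/-- The `l`-adic completion `N_l` of an `R`-module `N`; for `N = R` it is the completed ring `R_l`,
and `N_l` is a module over `R_l`. -/
abbrev LAdic (l : ℕ) (R : Type*) [CommRing R] (N : Type*) [AddCommGroup N] [Module R N] : Type _ :=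
  AdicCompletion (Ideal.span {(l : R)}) N

/-- A module `M` over a `ℤ_l`-order `Λ` has rank `e`: `M ⊗ ℚ_l` is free of rank `e` over `Λ ⊗ ℚ_l`
(tensor products over `ℤ_l`). Since `ℚ_l = ℤ_l[1/l]`, these are `M[1/l]` and `Λ[1/l]`. -/
def HasRank (l : ℕ) (Λ : Type*) [CommRing Λ] (M : Type*) [AddCommGroup M] [Module Λ M]
    (e : ℕ) : Prop :=
  Nonempty (LocalizedModule (Submonoid.powers (l : Λ)) M
    ≃ₗ[Localization (Submonoid.powers (l : Λ))]
      (Fin e → Localization (Submonoid.powers (l : Λ))))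

/-- The quotient `M / xM`. -/
abbrev ModBy {Λ : Type*} [CommRing Λ] (x : Λ) (M : Type*) [AddCommGroup M] [Module Λ M] : Type _ :=
  M ⧸ (LinearMap.range (LinearMap.lsmul Λ M x))

/-- The exceptional case: `l = 2`, `q` is not a square and `π = ±√((-1/p) q)`. -/
def IsExceptional (p q l : ℕ) (π : ℂ) : Prop :=
  l = 2 ∧ ¬ IsSquare q ∧ π ^ 2 = ((jacobiSym (-1) p : ℤ) : ℂ) * (q : ℂ)

/-! ### Indices of ranges of injective endomorphisms -/

/-! Write Λ = R_l and x = π - 1. Half of the proof is counting. M contains a copy of Λ^e with finite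
index, so [M : yM] = [Λ : yΛ]^e for every y dividing a power of l (`IsLattice.index_eq`). Hence M/xM
≅ (Λ/xΛ)^e as soon as M/xM is generated by e elements (`IsLattice.modBy_equiv`). That property,
`SpannedMod`, passes to powers, divisors and comaximal products of y, and it holds when yΛ is
maximal, because M/yM is then a vector space whose dimension can be counted.

Let F be the minimal polynomial of π over ℤ. The index of π - c in R is |F(c)|, so π - c generates a
maximal ideal of Λ when l divides F(c) exactly once. If moreover c ≡ 1 mod l, then x divides a power
of π - c, and M/xM is generated by e elements. `exists_eval_of_not_isExceptional` supplies c unless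
l ∤ F(1), in which case x is a unit. Its proof takes the least N > 0 with π^N = B an integer. If l ∤
N, the derivative of X^N - B shows that 1 is at most a simple root of F mod l. If l ∣ N, a repeated
factor at 1 is excluded by factoring X^N - B and evaluating the cofactor that F divides; this fails
only in the exceptional case.

In the exceptional case π^2 = D with D ≡ 1 mod 4. If R contains (1+π)/2, then 2 is unramified and
M/xM is still generated by e elements, so b = 0. Otherwise R is ℤ[√D] up to odd index, and Λ/xΛ is a
quotient of ℤ. Modules killed by x are then just abelian groups, and M/xM is determined by the
indices of 2^i (M/xM). Its order, a duality between its top and bottom layers, and a congruence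
modulo 4 leave one free parameter f (`IsLattice.exists_nsmulIndex_modBy`). It is 1 for Λ and 2 for
the ring of integers, which gives a = 2e - f and b = f - e. -/

lemma AddMonoidHom.index_range_comp {M : Type*} [AddCommGroup M] (f g : M →+ M)
    (hf : Function.Injective f) :
    (f.comp g).range.index = g.range.index * f.range.index := by
  have h : (f.comp g).range = g.range.map f := by
    rw [AddMonoidHom.range_comp]
  have hle : g.range.map f ≤ f.range := AddSubgroup.map_le_range f g.range
  rw [h, ← AddSubgroup.relIndex_mul_index hle]
  congr 1
  rw [AddMonoidHom.range_eq_map f, AddSubgroup.relIndex_map_map_of_injective _ _ hf,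
    AddSubgroup.relIndex_top_right]

/-- An injective endomorphism of `M` that restricts to an endomorphism `g` of a finite index
subgroup has the same index as `g`. -/
lemma AddMonoidHom.index_range_eq_of_comm {L M : Type*} [AddCommGroup L] [AddCommGroup M]
    (φ : L →+ M) (hφ : Function.Injective φ) (g : L →+ L) (f : M →+ M)
    (hf : Function.Injective f) (hcomm : ∀ a, φ (g a) = f (φ a)) (hfin : φ.range.index ≠ 0) :
    f.range.index = g.range.index := by
  -- The index in M of f(φ(L)) = φ(g(L)) is computed twice, through f(M) and through φ(L); the
  -- finite factor [M : φ(L)] then cancels.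
  have h1 : φ.range.map f = g.range.map φ := by
    ext m
    constructor
    · rintro ⟨_, ⟨a, rfl⟩, rfl⟩
      exact ⟨g a, ⟨a, rfl⟩, hcomm a⟩
    · rintro ⟨_, ⟨a, rfl⟩, rfl⟩
      exact ⟨φ a, ⟨a, rfl⟩, (hcomm a).symm⟩
  have h2 : (g.range.map φ).relIndex φ.range = g.range.index := by
    rw [AddMonoidHom.range_eq_map φ, AddSubgroup.relIndex_map_map_of_injective _ _ hφ,
      AddSubgroup.relIndex_top_right]
  have h3 : (φ.range.map f).relIndex f.range = φ.range.index := by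
    rw [AddMonoidHom.range_eq_map f, AddSubgroup.relIndex_map_map_of_injective _ _ hf,
      AddSubgroup.relIndex_top_right]
  have e1 := AddSubgroup.relIndex_mul_index (AddSubgroup.map_le_range φ g.range)
  have e2 := AddSubgroup.relIndex_mul_index (AddSubgroup.map_le_range f φ.range)
  rw [h1] at e2 h3
  rw [h3, ← e1, h2, mul_comm] at e2
  exact Nat.eq_of_mul_eq_mul_right (Nat.pos_of_ne_zero hfin) e2

/-! ### Lattices over an `l`-adic order -/

/-- The properties of a `ℤ_l`-order used below. -/
structure IsAdicOrder (l : ℕ) (Λ : Type*) [CommRing Λ] : Prop where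
  prime : l.Prime
  regular : ∀ a : Λ, (l : Λ) * a = 0 → a = 0
  isUnit_one_add : ∀ a : Λ, IsUnit (1 + l * a)
  finite : Finite (Λ ⧸ Ideal.span {(l : Λ)})

/-- A finitely generated `l`-torsion-free module containing a free module of rank `e` with
quotient killed by a power of `l`. -/
structure IsLattice (l : ℕ) (Λ : Type*) [CommRing Λ] (M : Type*) [AddCommGroup M] [Module Λ M]
    (e : ℕ) : Prop where
  finite : Module.Finite Λ M
  regular : ∀ m : M, (l : Λ) • m = 0 → m = 0
  exists_map : ∃ (φ : (Fin e → Λ) →ₗ[Λ] M) (j : ℕ), Function.Injective φ ∧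
    ∀ m, (l : Λ) ^ j • m ∈ LinearMap.range φ

section Lattice

variable {l : ℕ} {Λ : Type*} [CommRing Λ] {M : Type*} [AddCommGroup M] [Module Λ M] {e : ℕ}

variable (M) in
/-- Multiplication by a scalar as an additive endomorphism. -/
def mulBy (y : Λ) : M →+ M := (LinearMap.lsmul Λ M y).toAddMonoidHom

@[simp] lemma mulBy_apply (y : Λ) (m : M) : mulBy M y m = y • m := rfl

lemma card_modBy (y : Λ) : Nat.card (ModBy y M) = (mulBy M y).range.index := rfl

lemma range_lsmul_self (y : Λ) : LinearMap.range (LinearMap.lsmul Λ Λ y) = Ideal.span {y} := by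
  ext a
  simp only [LinearMap.mem_range, LinearMap.lsmul_apply, smul_eq_mul, Ideal.mem_span_singleton']
  exact ⟨fun ⟨b, hb⟩ => ⟨b, by rw [mul_comm, hb]⟩, fun ⟨b, hb⟩ => ⟨b, by rw [mul_comm, hb]⟩⟩

lemma card_quotient_span (y : Λ) : Nat.card (Λ ⧸ Ideal.span {y}) = (mulBy Λ y).range.index := by
  rw [← card_modBy]
  exact Nat.card_congr (Submodule.quotEquivOfEq _ _ (range_lsmul_self y).symm).toEquiv

lemma mulBy_mul (y z : Λ) : mulBy M (y * z) = (mulBy M y).comp (mulBy M z) := by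
  ext m
  simp [mul_smul]

lemma range_mulBy_le_of_dvd {y z : Λ} (h : y ∣ z) : (mulBy M z).range ≤ (mulBy M y).range := by
  obtain ⟨w, rfl⟩ := h
  rintro _ ⟨m, rfl⟩
  exact ⟨w • m, by simp [mul_smul]⟩

/-- A Bézout relation a l + b u = 1 writes b u as 1 - l a, which is a unit. -/
lemma IsAdicOrder.isUnit_intCast (hΛ : IsAdicOrder l Λ) {u : ℤ} (hu : ¬ (l : ℤ) ∣ u) :
    IsUnit (u : Λ) := by
  have hc : IsCoprime (l : ℤ) u :=
    (Prime.coprime_iff_not_dvd (Nat.prime_iff_prime_int.mp hΛ.prime)).mpr hu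
  obtain ⟨a, b, hab⟩ := hc
  have h := hΛ.isUnit_one_add (-(a : Λ))
  have h2 : (1 + l * (-(a : Λ)) : Λ) = b * u := by
    have := congrArg (Int.cast : ℤ → Λ) hab
    push_cast at this
    rw [← this]
    ring
  rw [h2] at h
  exact isUnit_of_mul_isUnit_right h

lemma IsAdicOrder.mulBy_injective_pow (hreg : ∀ m : M, (l : Λ) • m = 0 → m = 0) (v : ℕ) :
    Function.Injective (mulBy M ((l : Λ) ^ v)) := by
  rw [injective_iff_map_eq_zero]
  induction v with
  | zero => intro a h; simpa using h
  | succ v ih =>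
    intro a h
    apply ih
    apply hreg
    rw [mulBy_apply, pow_succ', mul_smul] at h
    exact h

lemma mulBy_injective_of_dvd (hreg : ∀ m : M, (l : Λ) • m = 0 → m = 0) {y : Λ} {v : ℕ}
    (hy : y ∣ (l : Λ) ^ v) : Function.Injective (mulBy M y) := by
  obtain ⟨z, hz⟩ := hy
  have h := IsAdicOrder.mulBy_injective_pow (M := M) hreg v
  rw [hz, mul_comm, mulBy_mul, AddMonoidHom.coe_comp] at h
  exact h.of_comp

lemma IsAdicOrder.index_ne_zero (hΛ : IsAdicOrder l Λ) [Module.Finite Λ M] :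
    (mulBy M (l : Λ)).range.index ≠ 0 := by
  have := hΛ.finite
  have h1 : Finite (M ⧸ (Ideal.span {(l : Λ)} • ⊤ : Submodule Λ M)) :=
    Module.finite_of_finite (Λ ⧸ Ideal.span {(l : Λ)})
  rw [← card_modBy]
  have h2 : (Ideal.span {(l : Λ)} • ⊤ : Submodule Λ M) =
      LinearMap.range (LinearMap.lsmul Λ M (l : Λ)) := by
    ext m
    simp [Submodule.ideal_span_singleton_smul, Submodule.mem_smul_pointwise_iff_exists]
  rw [h2] at h1
  exact Nat.card_pos.ne'

lemma IsAdicOrder.index_pow_ne_zero (hΛ : IsAdicOrder l Λ) [Module.Finite Λ M]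
    (hreg : ∀ m : M, (l : Λ) • m = 0 → m = 0) (v : ℕ) :
    (mulBy M ((l : Λ) ^ v)).range.index ≠ 0 := by
  induction v with
  | zero =>
    have : (mulBy M ((l : Λ) ^ 0)).range = ⊤ := by
      rw [AddMonoidHom.range_eq_top]
      intro m
      exact ⟨m, by simp⟩
    rw [this]
    simp
  | succ v ih =>
    rw [pow_succ, mulBy_mul, AddMonoidHom.index_range_comp _ _
      (IsAdicOrder.mulBy_injective_pow hreg v)]
    exact mul_ne_zero hΛ.index_ne_zero ih

lemma IsLattice.index_ne_zero (hΛ : IsAdicOrder l Λ) (hM : IsLattice l Λ M e) {y : Λ} {v : ℕ}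
    (hy : y ∣ (l : Λ) ^ v) : (mulBy M y).range.index ≠ 0 := by
  have := hM.finite
  intro h
  have h1 := AddSubgroup.index_dvd_of_le (range_mulBy_le_of_dvd (M := M) hy)
  rw [h, zero_dvd_iff] at h1
  exact hΛ.index_pow_ne_zero hM.regular v h1

lemma index_range_mulBy_pi (y : Λ) (e : ℕ) :
    (mulBy (Fin e → Λ) y).range.index = (mulBy Λ y).range.index ^ e := by
  have h : (mulBy (Fin e → Λ) y).range = AddSubgroup.pi Set.univ fun _ => (mulBy Λ y).range := by
    ext f
    simp only [AddMonoidHom.mem_range, AddSubgroup.mem_pi, Set.mem_univ, forall_const]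
    constructor
    · rintro ⟨g, rfl⟩ i
      exact ⟨g i, rfl⟩
    · intro hf
      choose g hg using hf
      exact ⟨g, funext hg⟩
  rw [h, AddSubgroup.index_pi]
  simp

/-- The index of multiplication by `y` on a lattice depends only on the rank. -/
lemma IsLattice.index_eq (hΛ : IsAdicOrder l Λ) (hM : IsLattice l Λ M e) {y : Λ} {v : ℕ}
    (hy : y ∣ (l : Λ) ^ v) :
    (mulBy M y).range.index = (mulBy Λ y).range.index ^ e := by
  obtain ⟨φ, j, hφ, hj⟩ := hM.exists_map
  have := hM.finite
  rw [← index_range_mulBy_pi]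
  refine AddMonoidHom.index_range_eq_of_comm φ.toAddMonoidHom hφ _ _
    (mulBy_injective_of_dvd hM.regular hy) (fun a => φ.map_smul y a) ?_
  intro h
  -- The image of Λ^e has finite index because it contains l^j M.
  have hle : (mulBy M ((l : Λ) ^ j)).range ≤ φ.toAddMonoidHom.range := by
    rintro _ ⟨m, rfl⟩
    exact hj m
  have h1 := AddSubgroup.index_dvd_of_le hle
  rw [h, zero_dvd_iff] at h1
  exact hΛ.index_pow_ne_zero hM.regular j h1

/-! ### Generating the reduction of a lattice -/

/-- `M / yM` can be generated by `e` elements. -/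
def SpannedMod (e : ℕ) (y : Λ) (M : Type*) [AddCommGroup M] [Module Λ M] : Prop :=
  ∃ w : Fin e → M, ∀ m : M, ∃ (c : Fin e → Λ) (m' : M), m = ∑ i, c i • w i + y • m'

/-- The e generators define a surjection from (Λ/x)^e onto M/xM. By `IsLattice.index_eq` both sides
are finite of the same order, so it is bijective. -/
lemma IsLattice.modBy_equiv (hΛ : IsAdicOrder l Λ) (hM : IsLattice l Λ M e) {x : Λ} {v : ℕ}
    (hx : x ∣ (l : Λ) ^ v) (hs : SpannedMod e x M) :
    Nonempty (ModBy x M ≃ₗ[Λ] (Fin e → Λ ⧸ Ideal.span {x})) := by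
  obtain ⟨w, hw⟩ := hs
  let N := LinearMap.range (LinearMap.lsmul Λ M x)
  let one : Fin e → (Λ ⧸ Ideal.span {x}) →ₗ[Λ] ModBy x M := fun i =>
    (Ideal.span {x}).liftQ (N.mkQ ∘ₗ LinearMap.toSpanSingleton Λ M (w i)) (by
      rw [Ideal.span, Submodule.span_le, Set.singleton_subset_iff]
      simp only [SetLike.mem_coe, LinearMap.mem_ker, LinearMap.comp_apply,
        LinearMap.toSpanSingleton_apply, Submodule.mkQ_apply, Submodule.Quotient.mk_eq_zero]
      exact ⟨w i, rfl⟩)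
  let ψ : (Fin e → Λ ⧸ Ideal.span {x}) →ₗ[Λ] ModBy x M := LinearMap.lsum Λ _ ℕ one
  have hψ : Function.Surjective ψ := by
    intro m
    obtain ⟨m, rfl⟩ := Submodule.Quotient.mk_surjective _ m
    obtain ⟨c, m', rfl⟩ := hw m
    refine ⟨fun i => Submodule.Quotient.mk (c i), ?_⟩
    have : (Submodule.Quotient.mk (x • m') : ModBy x M) = 0 := by
      rw [Submodule.Quotient.mk_eq_zero]
      exact ⟨m', rfl⟩
    rw [Submodule.Quotient.mk_add, this, add_zero]
    simp only [ψ, LinearMap.lsum_apply, LinearMap.sum_apply, LinearMap.comp_apply,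
      LinearMap.proj_apply]
    rw [← Submodule.mkQ_apply, map_sum]
    refine Finset.sum_congr rfl fun i _ => ?_
    rfl
  have hc : Nat.card (ModBy x M) = Nat.card (Fin e → Λ ⧸ Ideal.span {x}) := by
    rw [card_modBy, hM.index_eq hΛ hx, Nat.card_fun, card_quotient_span]
    simp
  have hne : Nat.card (ModBy x M) ≠ 0 := by
    rw [card_modBy]
    exact hM.index_ne_zero hΛ hx
  have : Finite (ModBy x M) := Nat.finite_of_card_ne_zero hne
  have : Finite (Fin e → Λ ⧸ Ideal.span {x}) := Nat.finite_of_card_ne_zero (hc ▸ hne)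
  have hb : Function.Bijective ψ := (Nat.bijective_iff_surjective_and_card ψ).mpr ⟨hψ, hc.symm⟩
  exact ⟨(LinearEquiv.ofBijective ψ hb).symm⟩

/-- The same generators serve every power: the remainder m' is expanded again at each stage. -/
lemma SpannedMod.pow {y : Λ} (h : SpannedMod e y M) (k : ℕ) : SpannedMod e (y ^ k) M := by
  obtain ⟨w, hw⟩ := h
  refine ⟨w, fun m => ?_⟩
  induction k with
  | zero => exact ⟨0, m, by simp⟩
  | succ k ih =>
    obtain ⟨c, m', hm⟩ := ih
    obtain ⟨d, m'', hm'⟩ := hw m'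
    refine ⟨fun i => c i + y ^ k * d i, m'', ?_⟩
    rw [hm, hm', smul_add, ← add_assoc, smul_smul, ← pow_succ]
    congr 1
    simp [add_smul, Finset.sum_add_distrib, Finset.smul_sum, mul_smul]

lemma SpannedMod.of_dvd {x y : Λ} (h : SpannedMod e y M) (hxy : x ∣ y) : SpannedMod e x M := by
  obtain ⟨w, hw⟩ := h
  obtain ⟨z, rfl⟩ := hxy
  refine ⟨w, fun m => ?_⟩
  obtain ⟨c, m', hm⟩ := hw m
  exact ⟨c, z • m', by rw [hm, mul_smul]⟩

/-- Chinese remainder theorem: the elements b y₂ w₁ + a y₁ w₂ are congruent to w₁ modulo y₁ and to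
w₂ modulo y₂. They therefore generate modulo both, and expanding the remainder once more gives the
product. -/
lemma SpannedMod.mul {y₁ y₂ a b : Λ} (h₁ : SpannedMod e y₁ M) (h₂ : SpannedMod e y₂ M)
    (hab : a * y₁ + b * y₂ = 1) : SpannedMod e (y₁ * y₂) M := by
  obtain ⟨w₁, hw₁⟩ := h₁
  obtain ⟨w₂, hw₂⟩ := h₂
  have key : ∀ (y y' a b : Λ) (w w' : Fin e → M), a * y + b * y' = 1 →
      (∀ m : M, ∃ (c : Fin e → Λ) (m' : M), m = ∑ i, c i • w i + y • m') →
      ∀ m : M, ∃ (c : Fin e → Λ) (m' : M),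
        m = ∑ i, c i • ((b * y') • w i + (a * y) • w' i) + y • m' := by
    intro y y' a b w w' hab h m
    obtain ⟨c, m', hm⟩ := h m
    refine ⟨c, m' + a • ∑ i, c i • (w i - w' i), ?_⟩
    rw [hm, smul_add, add_comm (y • m'), ← add_assoc]
    congr 1
    rw [smul_smul, Finset.smul_sum, ← Finset.sum_add_distrib]
    refine Finset.sum_congr rfl fun i _ => ?_
    rw [smul_comm (y * a), ← smul_add]
    congr 1
    have hb : b * y' = 1 - a * y := by rw [← hab]; ring
    rw [hb, mul_comm y a]
    module
  refine ⟨fun i => (b * y₂) • w₁ i + (a * y₁) • w₂ i, fun m => ?_⟩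
  obtain ⟨c, m', hm⟩ := key y₁ y₂ a b w₁ w₂ hab hw₁ m
  obtain ⟨d, m'', hm'⟩ := key y₂ y₁ b a w₂ w₁ (by rw [add_comm, hab]) hw₂ m'
  refine ⟨fun i => c i + y₁ * d i, m'', ?_⟩
  rw [hm, hm', smul_add, ← add_assoc, smul_smul]
  congr 1
  simp_rw [add_comm ((a * y₁) • w₂ _)]
  simp only [add_smul, Finset.sum_add_distrib, Finset.smul_sum, mul_smul]

/-- M/yM is a vector space over the field Λ/y with |Λ/y|^e elements, so its dimension is e; a basis
lifts to the generators. -/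
lemma IsLattice.spannedMod_of_isMaximal (hΛ : IsAdicOrder l Λ) (hM : IsLattice l Λ M e) {y : Λ}
    {v : ℕ} (hy : y ∣ (l : Λ) ^ v) (hmax : (Ideal.span {y}).IsMaximal) :
    SpannedMod e y M := by
  let : Field (Λ ⧸ Ideal.span {y}) := Ideal.Quotient.field _
  let N : Submodule Λ M := Ideal.span {y} • ⊤
  have hN : N = LinearMap.range (LinearMap.lsmul Λ M y) := by
    ext m
    simp [N, Submodule.ideal_span_singleton_smul, Submodule.mem_smul_pointwise_iff_exists]
  have hcard : Nat.card (M ⧸ N) = Nat.card (Λ ⧸ Ideal.span {y}) ^ e := by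
    rw [hN, card_quotient_span, ← hM.index_eq hΛ hy]
    rfl
  have hΛlat : Nat.card (M ⧸ N) ≠ 0 := by
    rw [hN]
    exact hM.index_ne_zero hΛ hy
  have : Finite (M ⧸ N) := Nat.finite_of_card_ne_zero hΛlat
  have := hM.finite
  have hfr : Module.finrank (Λ ⧸ Ideal.span {y}) (M ⧸ N) = e := by
    rcases e with _ | e
    · rw [pow_zero] at hcard
      have : Subsingleton (M ⧸ N) := (Nat.card_eq_one_iff_unique.mp hcard).1
      simp [Module.finrank_zero_of_subsingleton]
    -- An infinite residue field would have `Nat.card` equal to 0, and then so would M/yM. This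
    -- needs a positive exponent, hence the separate treatment of rank 0.
    have : Finite (Λ ⧸ Ideal.span {y}) := by
      apply Nat.finite_of_card_ne_zero
      intro h0
      rw [h0] at hcard
      simp [hcard] at hΛlat
    have h := Module.natCard_eq_pow_finrank (K := Λ ⧸ Ideal.span {y}) (V := M ⧸ N)
    rw [hcard] at h
    exact (Nat.pow_right_injective (Finite.one_lt_card (α := Λ ⧸ Ideal.span {y})) h).symm
  let b : Module.Basis (Fin e) (Λ ⧸ Ideal.span {y}) (M ⧸ N) := Module.finBasisOfFinrankEq _ _ hfr
  choose w hw using fun i => Submodule.Quotient.mk_surjective N (b i)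
  refine ⟨w, fun m => ?_⟩
  have hm := b.sum_repr (Submodule.Quotient.mk m)
  choose c hc using fun i => Ideal.Quotient.mk_surjective (b.repr (Submodule.Quotient.mk m) i)
  have hsum : (Submodule.Quotient.mk (∑ i, c i • w i) : M ⧸ N) = Submodule.Quotient.mk m := by
    rw [← hm, ← Submodule.mkQ_apply, map_sum]
    refine Finset.sum_congr rfl fun i _ => ?_
    rw [← hc, map_smul, Submodule.mkQ_apply, hw]
    rfl
  have hdiff : m - ∑ i, c i • w i ∈ N := by
    rw [← Submodule.Quotient.mk_eq_zero, Submodule.Quotient.mk_sub, hsum, sub_self]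
  obtain ⟨m', hm'⟩ := hN.le hdiff
  refine ⟨c, m', ?_⟩
  rw [LinearMap.lsmul_apply] at hm'
  rw [hm']
  abel

end Lattice

/-! ### Classification of finite abelian `p`-groups by the indices of `p ^ i G` -/

section AbelianPGroup

/-- The index of `n G` in an abelian group `G`. -/
noncomputable def nsmulIndex (n : ℕ) (G : Type*) [AddCommGroup G] : ℕ :=
  (nsmulAddMonoidHom n : G →+ G).range.index

lemma nsmulIndex_congr {G H : Type*} [AddCommGroup G] [AddCommGroup H] (f : G ≃+ H) (n : ℕ) :
    nsmulIndex n G = nsmulIndex n H := by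
  have h : (nsmulAddMonoidHom n : H →+ H).range =
      ((nsmulAddMonoidHom n : G →+ G).range).map (f : G →+ H) := by
    ext y
    constructor
    · rintro ⟨z, rfl⟩
      exact ⟨n • f.symm z, ⟨f.symm z, rfl⟩, by simp⟩
    · rintro ⟨_, ⟨z, rfl⟩, rfl⟩
      exact ⟨f z, by simp⟩
  rw [nsmulIndex, nsmulIndex, h, AddSubgroup.index_map_equiv]

lemma nsmulIndex_zmod (n m : ℕ) [NeZero m] : nsmulIndex n (ZMod m) = m.gcd n := by
  have h := IsCyclic.index_powMonoidHom_range (G := Multiplicative (ZMod m)) n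
  rw [Nat.card_congr (Multiplicative.toAdd (α := ZMod m)), Nat.card_zmod] at h
  rw [← h]
  rfl

lemma nsmulIndex_pi {ι : Type*} [Fintype ι] (G : ι → Type*) [∀ i, AddCommGroup (G i)] (n : ℕ) :
    nsmulIndex n (∀ i, G i) = ∏ i, nsmulIndex n (G i) := by
  have h : (nsmulAddMonoidHom n : (∀ i, G i) →+ (∀ i, G i)).range =
      AddSubgroup.pi Set.univ fun i => (nsmulAddMonoidHom n : G i →+ G i).range := by
    ext f
    simp only [AddMonoidHom.mem_range, AddSubgroup.mem_pi, Set.mem_univ, forall_const]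
    constructor
    · rintro ⟨g, rfl⟩ i
      exact ⟨g i, rfl⟩
    · intro hf
      choose g hg using hf
      exact ⟨g, funext hg⟩
  simp only [nsmulIndex, h, AddSubgroup.index]
  rw [← Nat.card_pi]
  refine Nat.card_congr
    ((Quotient.congrRight (fun a b => ?_)).trans (Setoid.piQuotientEquiv _).symm)
  rw [QuotientAddGroup.leftRel_pi]

lemma nsmulIndex_prod (G H : Type*) [AddCommGroup G] [AddCommGroup H] (n : ℕ) :
    nsmulIndex n (G × H) = nsmulIndex n G * nsmulIndex n H := by
  have h : (nsmulAddMonoidHom n : (G × H) →+ (G × H)).range =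
      ((nsmulAddMonoidHom n : G →+ G).range).prod (nsmulAddMonoidHom n : H →+ H).range := by
    ext ⟨a, b⟩
    simp only [AddMonoidHom.mem_range, AddSubgroup.mem_prod]
    constructor
    · rintro ⟨⟨c, d⟩, h⟩
      exact ⟨⟨c, congrArg Prod.fst h⟩, ⟨d, congrArg Prod.snd h⟩⟩
    · rintro ⟨⟨c, hc⟩, ⟨d, hd⟩⟩
      exact ⟨(c, d), Prod.ext hc hd⟩
  rw [nsmulIndex, h, AddSubgroup.index_prod]
  rfl

variable {p : ℕ}

lemma exists_addEquiv_pi_zmod_pow (hp : p.Prime) (G : Type*) [AddCommGroup G] [Finite G] {n : ℕ}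
    (hG : ∀ g : G, p ^ n • g = 0) :
    ∃ (ι : Type) (_ : Fintype ι) (k : ι → ℕ), (∀ i, 0 < k i) ∧ (∀ i, k i ≤ n) ∧
      Nonempty (G ≃+ ∀ i, ZMod (p ^ k i)) := by
  classical
  obtain ⟨ι, _, m, hm, ⟨f⟩⟩ := AddCommGroup.equiv_directSum_zmod_of_finite' G
  have hdvd : ∀ i, m i ∣ p ^ n := by
    intro i
    have h := hG (f.symm (DirectSum.of (fun i => ZMod (m i)) i 1))
    rw [← map_nsmul, map_eq_zero_iff _ f.symm.injective, ← map_nsmul] at h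
    have h2 := congrArg (fun z => z i) h
    simp only [DirectSum.of_eq_same, nsmul_one, DirectSum.zero_apply] at h2
    exact (ZMod.natCast_eq_zero_iff _ _).mp h2
  choose k hk hmk using fun i => (Nat.dvd_prime_pow hp).mp (hdvd i)
  refine ⟨ι, inferInstance, k, fun i => ?_, hk, ?_⟩
  · rcases Nat.eq_zero_or_pos (k i) with h | h
    · have := hm i
      rw [hmk, h] at this
      simp at this
    · exact h
  · have : m = fun i => p ^ k i := funext hmk
    subst this
    exact ⟨f.trans (DirectSum.addEquivProd _)⟩

lemma nsmulIndex_pi_zmod_pow (hp : p.Prime) {ι : Type*} [Fintype ι] (k : ι → ℕ) (i : ℕ) :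
    nsmulIndex (p ^ i) (∀ j, ZMod (p ^ k j)) = p ^ ∑ j, min (k j) i := by
  have : ∀ j, NeZero (p ^ k j) := fun j => ⟨(pow_pos hp.pos _).ne'⟩
  rw [nsmulIndex_pi, ← Finset.prod_pow_eq_pow_sum]
  refine Finset.prod_congr rfl fun j _ => ?_
  rw [nsmulIndex_zmod]
  rcases le_total (k j) i with h | h
  · rw [min_eq_left h]
    exact Nat.gcd_eq_left (pow_dvd_pow p h)
  · rw [min_eq_right h]
    exact Nat.gcd_eq_right (pow_dvd_pow p h)

lemma sum_min_succ {ι : Type*} [Fintype ι] (k : ι → ℕ) (i : ℕ) :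
    ∑ j, min (k j) (i + 1) = ∑ j, min (k j) i + (Finset.univ.filter fun j => i < k j).card := by
  rw [Finset.card_filter, ← Finset.sum_add_distrib]
  refine Finset.sum_congr rfl fun j _ => ?_
  split_ifs <;> omega

/-- Finite abelian groups of `p`-power exponent are determined by the indices of `p ^ i G`. -/
lemma nonempty_addEquiv_of_nsmulIndex_eq (hp : p.Prime) {G H : Type*} [AddCommGroup G]
    [AddCommGroup H] [Finite G] [Finite H] {n : ℕ} (hG : ∀ g : G, p ^ n • g = 0)
    (hH : ∀ g : H, p ^ n • g = 0)
    (h : ∀ i ≤ n, nsmulIndex (p ^ i) G = nsmulIndex (p ^ i) H) : Nonempty (G ≃+ H) := by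
  classical
  obtain ⟨ι, _, k, hk0, hkn, ⟨f⟩⟩ := exists_addEquiv_pi_zmod_pow hp G hG
  obtain ⟨κ, _, m, hm0, hmn, ⟨g⟩⟩ := exists_addEquiv_pi_zmod_pow hp H hH
  -- The logarithm of the index of p^i G is the sum of the min(k j, i). Its increments count the
  -- exponents exceeding i, and differences of these counts give the multiplicity of each exponent.
  -- Exponent 0 is invisible here, which is why the decomposition has only positive exponents.
  have hs : ∀ i ≤ n, ∑ j, min (k j) i = ∑ j, min (m j) i := by
    intro i hi
    have := h i hi
    rw [nsmulIndex_congr f, nsmulIndex_congr g, nsmulIndex_pi_zmod_pow hp,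
      nsmulIndex_pi_zmod_pow hp] at this
    exact Nat.pow_right_injective hp.two_le this
  have hc : ∀ i, (Finset.univ.filter fun j => i < k j).card =
      (Finset.univ.filter fun j => i < m j).card := by
    intro i
    rcases lt_or_ge i n with hi | hi
    · have h1 := sum_min_succ k i
      have h2 := sum_min_succ m i
      have h3 := hs i hi.le
      have h4 := hs (i + 1) hi
      omega
    · rw [Finset.filter_false_of_mem fun j _ => ?_, Finset.filter_false_of_mem fun j _ => ?_]
      · rfl
      · have := hmn j; omega
      · have := hkn j; omega
  have hfib : ∀ {α : Type} [Fintype α] (k : α → ℕ) (i : ℕ),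
      Fintype.card {j // k j = i + 1} = (Finset.univ.filter fun j => i < k j).card -
        (Finset.univ.filter fun j => i + 1 < k j).card := by
    intro α _ k i
    rw [Fintype.card_subtype]
    symm
    rw [Nat.sub_eq_iff_eq_add (Finset.card_le_card fun j => by
      simp only [Finset.mem_filter, Finset.mem_univ, true_and]; omega)]
    rw [← Finset.card_union_of_disjoint]
    · congr 1
      ext j
      simp only [Finset.mem_filter, Finset.mem_univ, true_and, Finset.mem_union]
      omega
    · rw [Finset.disjoint_filter]
      intro j _ h1 h2
      omega
  have hequiv : ∀ c, Nonempty ({j // k j = c} ≃ {j // m j = c}) := by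
    intro c
    rcases c with _ | i
    · have : IsEmpty {j // k j = 0} := ⟨fun j => (hk0 j.1).ne' j.2⟩
      have : IsEmpty {j // m j = 0} := ⟨fun j => (hm0 j.1).ne' j.2⟩
      exact ⟨Equiv.equivOfIsEmpty _ _⟩
    · exact ⟨Fintype.equivOfCardEq (by rw [hfib, hfib, hc, hc])⟩
  let E : ι ≃ κ := Equiv.ofFiberEquiv fun c => (hequiv c).some
  have hE : ∀ j, m (E j) = k j := fun j => Equiv.ofFiberEquiv_map _ j
  have F : (∀ j, ZMod (p ^ k j)) ≃+ ∀ j, ZMod (p ^ m j) :=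
    (AddEquiv.piCongrRight fun j =>
      (ZMod.ringEquivCongr (by rw [hE])).toAddEquiv).trans
      (RingEquiv.piCongrLeft (fun j => ZMod (p ^ m j)) E).toAddEquiv
  exact ⟨(f.trans F).trans g.symm⟩

end AbelianPGroup

/-! ### Completions and localizations -/

section Completion

/-- Denominators are cleared in a basis of M[1/l]: b i is an element of M whose image is l^(k i)
times the i-th basis vector. -/
lemma HasRank.isLattice {l : ℕ} {Λ : Type*} [CommRing Λ] (hΛ : IsAdicOrder l Λ)
    {M : Type*} [AddCommGroup M] [Module Λ M] [hfin : Module.Finite Λ M]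
    (hreg : ∀ m : M, (l : Λ) • m = 0 → m = 0) {e : ℕ} (h : HasRank l Λ M e) :
    IsLattice l Λ M e := by
  obtain ⟨E⟩ := h
  let S := Submonoid.powers (l : Λ)
  let A := Localization S
  let ι := LocalizedModule.mkLinearMap S M
  have hEsmul : ∀ (r : Λ) (z : LocalizedModule S M) (i : Fin e),
      E (r • z) i = algebraMap Λ A r * E z i := by
    intro r z i
    rw [← algebraMap_smul A r z, map_smul, Pi.smul_apply, smul_eq_mul]
  have hinj : ∀ m : M, E (ι m) = 0 → m = 0 := by
    intro m hm
    rw [E.map_eq_zero_iff] at hm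
    rw [← map_zero ι, IsLocalizedModule.eq_iff_exists S ι] at hm
    obtain ⟨⟨_, n, rfl⟩, hc⟩ := hm
    rw [smul_zero] at hc
    apply IsAdicOrder.mulBy_injective_pow (Λ := Λ) hreg n
    rw [map_zero]
    exact hc
  have hAinj : ∀ (a : Λ) (n : ℕ), algebraMap Λ A (a * (l : Λ) ^ n) = 0 → a = 0 := by
    intro a n ha
    rw [IsLocalization.map_eq_zero_iff S] at ha
    obtain ⟨⟨_, n', rfl⟩, hc⟩ := ha
    have hc' : (l : Λ) ^ (n' + n) * a = 0 := by
      rw [pow_add, mul_assoc, mul_comm _ a]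
      exact hc
    apply IsAdicOrder.mulBy_injective_pow (Λ := Λ) (M := Λ) hΛ.regular (n' + n)
    rw [map_zero]
    exact hc'
  have hb : ∀ i : Fin e, ∃ (m : M) (k : ℕ), E (ι m) = fun j =>
      algebraMap Λ A ((l : Λ) ^ k) * (Pi.single i 1 : Fin e → A) j := by
    intro i
    obtain ⟨⟨m, ⟨_, k, rfl⟩⟩, hmk⟩ := IsLocalizedModule.surj S ι (E.symm (Pi.single i 1))
    refine ⟨m, k, ?_⟩
    simp only at hmk
    rw [← hmk]
    ext j
    rw [Submonoid.smul_def, hEsmul]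
    simp
  choose b k hbk using hb
  let φ : (Fin e → Λ) →ₗ[Λ] M := Fintype.linearCombination Λ b
  have hφ : ∀ (c : Fin e → Λ) (i : Fin e), E (ι (φ c)) i = algebraMap Λ A (c i * (l : Λ) ^ k i) := by
    intro c i
    rw [Fintype.linearCombination_apply, map_sum, map_sum, Finset.sum_apply]
    rw [Finset.sum_eq_single i]
    · rw [map_smul, hEsmul, hbk, map_mul]
      simp
    · intro j _ hj
      rw [map_smul, hEsmul, hbk]
      simp [Pi.single_eq_of_ne hj.symm]
    · simp
  have hinjφ : Function.Injective φ := by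
    rw [injective_iff_map_eq_zero]
    intro c hc
    ext i
    have := hφ c i
    rw [hc, map_zero, map_zero, Pi.zero_apply] at this
    exact hAinj _ _ this.symm
  have hrange : ∀ m : M, ∃ j : ℕ, (l : Λ) ^ j • m ∈ LinearMap.range φ := by
    intro m
    obtain ⟨⟨_, n, rfl⟩, hn⟩ := IsLocalization.exist_integer_multiples_of_finite S (E (ι m))
    choose a ha using hn
    have hk : ∀ i, k i ≤ ∑ i, k i := fun i => Finset.single_le_sum (fun _ _ => Nat.zero_le _)
      (Finset.mem_univ i)
    -- The coordinates of m are a i / l^n, while φ scales the i-th coordinate by l^(k i). The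
    -- exponent ∑ k exceeds every k i, and the factor l^(∑ k - k i) makes up the difference.
    refine ⟨∑ i, k i + n, fun i => a i * (l : Λ) ^ (∑ i, k i - k i), ?_⟩
    rw [← sub_eq_zero]
    apply hinj
    rw [map_sub, map_sub, sub_eq_zero]
    ext i
    rw [hφ, map_smul, hEsmul, mul_assoc, ← pow_add, Nat.sub_add_cancel (hk i), map_mul, ha,
      pow_add, map_mul, Algebra.smul_def]
    ring
  refine ⟨hfin, hreg, φ, ?_⟩
  obtain ⟨s, hs⟩ := hfin.fg_top
  choose j hj using hrange
  refine ⟨∑ m ∈ s, j m, hinjφ, fun m => ?_⟩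
  have hle : (⊤ : Submodule Λ M) ≤
      (LinearMap.range φ).comap (LinearMap.lsmul Λ M ((l : Λ) ^ ∑ m ∈ s, j m)) := by
    rw [← hs, Submodule.span_le]
    intro m hm
    have h1 : j m ≤ ∑ m ∈ s, j m := Finset.single_le_sum (fun _ _ => Nat.zero_le _) hm
    change (l : Λ) ^ (∑ m ∈ s, j m) • m ∈ LinearMap.range φ
    rw [← Nat.sub_add_cancel h1, pow_add, mul_smul]
    exact Submodule.smul_mem _ _ (hj m)
  exact hle (Submodule.mem_top (x := m))

variable {l : ℕ} {R : Type*} [CommRing R] {N : Type*} [AddCommGroup N] [Module R N]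

lemma mem_span_pow_smul_top {n : ℕ} {y : N} :
    y ∈ (Ideal.span {(l : R)} ^ n • ⊤ : Submodule R N) ↔ ∃ z : N, y = (l : R) ^ n • z := by
  rw [Ideal.span_singleton_pow, Submodule.ideal_span_singleton_smul,
    Submodule.mem_smul_pointwise_iff_exists]
  simp [eq_comm]

/-- The component of m at level n is read from level n + 1: if l y lies in l^(n+1) N, then y lies in
l^n N because l is regular on N. -/
lemma LAdic.regular (hN : ∀ y : N, (l : R) • y = 0 → y = 0) (m : LAdic l R N)
    (hm : (l : LAdic l R R) • m = 0) : m = 0 := by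
  have hm' : (l : R) • m = 0 := by
    rw [← hm, ← algebraMap_smul (LAdic l R R) (l : R) m, map_natCast]
  apply AdicCompletion.ext
  intro n
  have h1 := congrArg (fun z => z.val (n + 1)) hm'
  simp only [AdicCompletion.val_smul_apply, AdicCompletion.val_zero_apply] at h1
  obtain ⟨y, hy⟩ := Submodule.Quotient.mk_surjective _ (m.val (n + 1))
  rw [← hy, ← Submodule.Quotient.mk_smul, Submodule.Quotient.mk_eq_zero,
    mem_span_pow_smul_top] at h1
  obtain ⟨z, hz⟩ := h1
  have h2 : y = (l : R) ^ n • z := by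
    rw [← sub_eq_zero]
    apply hN
    rw [smul_sub, hz, smul_smul, ← pow_succ', sub_self]
  have h3 := AdicCompletion.transitionMap_comp_eval_apply (I := Ideal.span {(l : R)}) (M := N)
    (show n ≤ n + 1 from Nat.le_succ n) m
  rw [AdicCompletion.val_zero_apply, ← h3, ← hy]
  have h4 : (Submodule.Quotient.mk y :
      N ⧸ (Ideal.span {(l : R)} ^ n • ⊤ : Submodule R N)) = 0 := by
    rw [Submodule.Quotient.mk_eq_zero, mem_span_pow_smul_top]
    exact ⟨z, h2⟩
  exact h4

/-- The kernel of evaluation at level n is l^n times the completion, since the ideal is finitely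
generated; so N is dense. -/
lemma LAdic.exists_eq_add (m : LAdic l R N) (n : ℕ) :
    ∃ (y : N) (m' : LAdic l R N),
      m = AdicCompletion.of _ N y + (l : LAdic l R R) ^ n • m' := by
  obtain ⟨y, hy⟩ := Submodule.Quotient.mk_surjective _ (m.val n)
  have h1 : m - AdicCompletion.of _ N y ∈
      LinearMap.ker (AdicCompletion.eval (Ideal.span {(l : R)}) N n) := by
    rw [LinearMap.mem_ker, map_sub, AdicCompletion.eval_of, AdicCompletion.eval_apply, ← hy,
      Submodule.mkQ_apply, sub_self]
  rw [← AdicCompletion.pow_smul_top_eq_ker_eval (Submodule.fg_span_singleton _),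
    mem_span_pow_smul_top] at h1
  obtain ⟨m', hm'⟩ := h1
  refine ⟨y, m', ?_⟩
  rw [← sub_eq_iff_eq_add', hm', ← algebraMap_smul (LAdic l R R) ((l : R) ^ n) m', map_pow,
    map_natCast]

lemma LAdic.exists_eq_smul {y : N} {n : ℕ} {m : LAdic l R N}
    (h : AdicCompletion.of _ N y = (l : LAdic l R R) ^ n • m) : ∃ z : N, y = (l : R) ^ n • z := by
  rw [← mem_span_pow_smul_top (l := l) (R := R)]
  have h1 : AdicCompletion.of _ N y ∈
      LinearMap.ker (AdicCompletion.eval (Ideal.span {(l : R)}) N n) := by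
    rw [← AdicCompletion.pow_smul_top_eq_ker_eval (Submodule.fg_span_singleton _),
      mem_span_pow_smul_top]
    refine ⟨m, ?_⟩
    rw [h, ← algebraMap_smul (LAdic l R R) ((l : R) ^ n) m, map_pow, map_natCast]
  rw [LinearMap.mem_ker, AdicCompletion.eval_of, Submodule.mkQ_apply,
    Submodule.Quotient.mk_eq_zero] at h1
  exact h1

lemma LAdic.exists_eq_algebraMap_add (a : LAdic l R R) (n : ℕ) :
    ∃ (r : R) (a' : LAdic l R R),
      a = algebraMap R (LAdic l R R) r + (l : LAdic l R R) ^ n * a' :=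
  LAdic.exists_eq_add a n

lemma LAdic.exists_eq_mul {r : R} {n : ℕ} {a : LAdic l R R}
    (h : algebraMap R (LAdic l R R) r = (l : LAdic l R R) ^ n * a) :
    ∃ r' : R, r = (l : R) ^ n * r' :=
  LAdic.exists_eq_smul (N := R) h

lemma LAdic.isAdicOrder (hl : l.Prime) (hreg : ∀ y : R, (l : R) * y = 0 → y = 0)
    (hfin : Finite (R ⧸ Ideal.span {(l : R)})) : IsAdicOrder l (LAdic l R R) where
  prime := hl
  regular := fun a ha => LAdic.regular hreg a ha
  isUnit_one_add := by
    intro a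
    have h0 : IsAdicComplete ((Ideal.span {(l : R)}).map (algebraMap R (LAdic l R R)))
        (LAdic l R R) := by
      rw [IsAdicComplete.map_algebraMap_iff]
      exact AdicCompletion.isAdicComplete (Submodule.fg_span_singleton _)
    have h1 := IsAdicComplete.le_jacobson_bot
      ((Ideal.span {(l : R)}).map (algebraMap R (LAdic l R R)))
    have h2 : (l : LAdic l R R) ∈ (Ideal.span {(l : R)}).map (algebraMap R (LAdic l R R)) := by
      rw [← map_natCast (algebraMap R (LAdic l R R))]
      exact Ideal.mem_map_of_mem _ (Ideal.mem_span_singleton_self _)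
    have h3 := Ideal.mem_jacobson_bot.mp (h1 h2) a
    rwa [add_comm] at h3
  finite := by
    refine Finite.of_surjective
      (f := Ideal.Quotient.lift (Ideal.span {(l : R)})
        ((Ideal.Quotient.mk (Ideal.span {(l : LAdic l R R)})).comp (algebraMap R (LAdic l R R)))
        ?_) ?_
    · intro a ha
      rw [Ideal.mem_span_singleton'] at ha
      obtain ⟨c, rfl⟩ := ha
      rw [RingHom.comp_apply, map_mul, map_natCast, Ideal.Quotient.eq_zero_iff_mem]
      exact Ideal.mul_mem_left _ _ (Ideal.mem_span_singleton_self _)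
    · intro z
      obtain ⟨z, rfl⟩ := Ideal.Quotient.mk_surjective z
      obtain ⟨y, m', hz⟩ := LAdic.exists_eq_algebraMap_add z 1
      refine ⟨Ideal.Quotient.mk _ y, ?_⟩
      rw [Ideal.Quotient.lift_mk, RingHom.comp_apply, Ideal.Quotient.eq, hz,
        Ideal.mem_span_singleton']
      exact ⟨-m', by ring⟩

end Completion

/-! ### Orders and their completions -/

section Order

lemma index_range_mulBy_int_ne_zero {A : Type*} [AddCommGroup A] [Module.Finite ℤ A] {d : ℤ}
    (hd : d ≠ 0) : (mulBy A d).range.index ≠ 0 := by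
  have : NeZero d.natAbs := ⟨by simpa using hd⟩
  have : Finite (ℤ ⧸ Ideal.span {d}) :=
    Finite.of_equiv _ (Int.quotientSpanEquivZMod d).symm.toEquiv
  have h1 : Finite (A ⧸ (Ideal.span {d} • ⊤ : Submodule ℤ A)) :=
    Module.finite_of_finite (ℤ ⧸ Ideal.span {d})
  rw [← card_modBy]
  have h2 : (Ideal.span {d} • ⊤ : Submodule ℤ A) =
      LinearMap.range (LinearMap.lsmul ℤ A d) := by
    ext m
    simp [Submodule.ideal_span_singleton_smul, Submodule.mem_smul_pointwise_iff_exists]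
  rw [h2] at h1
  exact Nat.card_pos.ne'

lemma prime_dvd_of_forall_nsmul_eq_zero {A : Type*} [AddCommGroup A] [Finite A] {n p : ℕ}
    (hp : p.Prime) (hA : ∀ a : A, n • a = 0) (hpA : p ∣ Nat.card A) : p ∣ n := by
  have : Fact p.Prime := ⟨hp⟩
  obtain ⟨a, ha⟩ := exists_prime_addOrderOf_dvd_card' p hpA
  rw [← ha]
  exact addOrderOf_dvd_of_nsmul_eq_zero (hA a)

variable {R : Type*} [CommRing R]

open Polynomial in
/-- If `F` generates the ideal of integral relations of `θ` and `R` is an order containing `ℤ[θ]`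
with finite index, then `θ - c` has index `|F(c)|` in `R`. -/
lemma index_range_mulBy_sub_intCast [IsDomain R] [CharZero R] [Module.Finite ℤ R] {θ : R}
    {F : ℤ[X]} (hF : aeval θ F = 0) (hmin : ∀ P : ℤ[X], aeval θ P = 0 → F ∣ P)
    (hgen : ∀ r : R, ∃ (d : ℤ) (P : ℤ[X]), d ≠ 0 ∧ d • r = aeval θ P) {c : ℤ}
    (hc : F.eval c ≠ 0) :
    (mulBy R (θ - c)).range.index = (F.eval c).natAbs := by
  classical
  let L := (aeval (R := ℤ) θ).range
  let θL : L := ⟨θ, X, by simp⟩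
  have hne : θ - c ≠ 0 := by
    intro h
    rw [sub_eq_zero] at h
    rw [h, ← eq_intCast (algebraMap ℤ R) c, aeval_algebraMap_apply, eq_intCast,
      Int.cast_eq_zero, coe_aeval_eq_eval] at hF
    exact hc hF
  -- A product of denominators of generators multiplies R into ℤ[θ]. Having finite index, ℤ[θ] may
  -- replace R, and there the quotient by θ - c is ℤ[X]/(F, X - c) ≅ ℤ/F(c).
  have hfin : (L.val : L →+ R).range.index ≠ 0 := by
    obtain ⟨s, hs⟩ := Module.Finite.fg_top (R := ℤ) (M := R)
    choose d P hd hP using hgen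
    have hle : (⊤ : Submodule ℤ R) ≤
        (Subalgebra.toSubmodule L).comap (LinearMap.lsmul ℤ R (∏ r ∈ s, d r)) := by
      rw [← hs, Submodule.span_le]
      intro r hr
      change (∏ r ∈ s, d r) • r ∈ L
      rw [← Finset.prod_erase_mul s d hr, mul_smul, hP]
      exact L.smul_mem ⟨P r, rfl⟩ _
    have hle' : (mulBy R (∏ r ∈ s, d r)).range ≤ (L.val : L →+ R).range := by
      rintro _ ⟨r, rfl⟩
      have h := hle (Submodule.mem_top (x := r))
      exact ⟨⟨_, h⟩, rfl⟩
    intro h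
    have h1 := AddSubgroup.index_dvd_of_le hle'
    rw [h, zero_dvd_iff] at h1
    exact index_range_mulBy_int_ne_zero (Finset.prod_ne_zero_iff.mpr fun r _ => hd r) h1
  rw [AddMonoidHom.index_range_eq_of_comm (L.val : L →+ R) Subtype.val_injective
    (mulBy L (θL - c)) (mulBy R (θ - c)) ?_ (fun a => ?_) hfin]
  · let ev : ℤ[X] →+ L := ((aeval (R := ℤ) θ).rangeRestrict : ℤ[X] →+ L)
    have hev : Function.Surjective ev := (aeval (R := ℤ) θ).rangeRestrict_surjective
    have hval : ∀ P, (ev P : R) = aeval θ P := fun P => rfl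
    let ec : ℤ[X] →+ ℤ := (evalRingHom c : ℤ[X] →+ ℤ)
    have hec : Function.Surjective ec := fun n => ⟨C n, by simp [ec]⟩
    have hcomap : (mulBy L (θL - c)).range.comap ev =
        (AddSubgroup.zmultiples (F.eval c)).comap ec := by
      ext P
      rw [AddSubgroup.mem_comap, AddSubgroup.mem_comap, Int.mem_zmultiples_iff]
      change _ ↔ F.eval c ∣ P.eval c
      constructor
      · rintro ⟨a, ha⟩
        obtain ⟨Q, rfl⟩ := hev a
        have h1 : aeval θ (P - (X - C c) * Q) = 0 := by
          have h2 := congrArg (fun z : L => (z : R)) ha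
          simp only [mulBy_apply, smul_eq_mul, MulMemClass.coe_mul, hval] at h2
          rw [map_sub, map_mul, ← h2]
          simp [θL]
        obtain ⟨W, hW⟩ := hmin _ h1
        have h3 := congrArg (eval c) hW
        simp only [eval_sub, eval_mul, eval_X, eval_C, sub_self, zero_mul, sub_zero] at h3
        exact ⟨_, h3⟩
      · rintro ⟨n, hn⟩
        have h1 : (X - C c) ∣ P - C n * F := by
          rw [dvd_iff_isRoot, IsRoot.def, eval_sub, eval_mul, eval_C, hn]
          ring
        obtain ⟨Q, hQ⟩ := h1
        refine ⟨ev Q, Subtype.ext ?_⟩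
        simp only [mulBy_apply, smul_eq_mul, MulMemClass.coe_mul, hval]
        have h2 := congrArg (aeval θ) hQ
        rw [map_sub, map_mul, hF, mul_zero, sub_zero] at h2
        rw [h2, map_mul]
        simp [θL]
    rw [← AddSubgroup.index_comap_of_surjective _ hev, hcomap,
      AddSubgroup.index_comap_of_surjective _ hec, Int.index_zmultiples]
  · intro a b hab
    exact mul_left_cancel₀ hne hab
  · simp [θL]

variable {l : ℕ}

/-- The index of an element in the completion is the `l`-part of its index in the order. -/
lemma LAdic.index_range_mulBy (hl : l.Prime) {r s : R} {v : ℕ} {u : ℤ} (hu : ¬ (l : ℤ) ∣ u)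
    (hunit : IsUnit (u : LAdic l R R))
    (hrs : r * s = (l : R) ^ v * u) (hcard : (mulBy R r).range.index = l ^ v * u.natAbs) :
    (mulBy (LAdic l R R) (algebraMap R (LAdic l R R) r)).range.index = l ^ v := by
  set y := algebraMap R (LAdic l R R) r with hy
  have hdvd : y ∣ (l : LAdic l R R) ^ v := by
    have h := congrArg (algebraMap R (LAdic l R R)) hrs
    rw [map_mul, map_mul, map_pow, map_natCast, map_intCast] at h
    obtain ⟨w, hw⟩ := hunit.exists_right_inv
    refine ⟨algebraMap R (LAdic l R R) s * w, ?_⟩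
    rw [← mul_assoc, ← hy.symm, h, mul_assoc, hw, mul_one]
  have hu0 : u.natAbs ≠ 0 := by
    intro h
    rw [Int.natAbs_eq_zero] at h
    exact hu (h ▸ dvd_zero _)
  have hlu : ¬ l ∣ u.natAbs := fun h => hu (Int.natCast_dvd.mpr h)
  -- T is the preimage in R of the ideal generated by y. The group R/T is the quotient of the
  -- completion by y and is killed by l^v, while T/rR is killed by u. Hence in l^v |u| = [T : rR] [R
  -- : T] the two factors are the parts prime to l and at l.
  let T : AddSubgroup R :=
    (mulBy (LAdic l R R) y).range.comap (algebraMap R (LAdic l R R) : R →+ LAdic l R R)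
  have hTmem : ∀ t : R, t ∈ T ↔ ∃ a, y * a = algebraMap R (LAdic l R R) t := fun t => Iff.rfl
  have hT : T.index = (mulBy (LAdic l R R) y).range.index := by
    change Nat.card _ = Nat.card _
    let q := QuotientAddGroup.mk' (mulBy (LAdic l R R) y).range
    have hq : Function.Surjective (q.comp (algebraMap R (LAdic l R R) : R →+ LAdic l R R)) := by
      intro z
      obtain ⟨z, rfl⟩ := QuotientAddGroup.mk'_surjective _ z
      obtain ⟨t, a, hz⟩ := LAdic.exists_eq_algebraMap_add z v
      obtain ⟨w, hw⟩ := hdvd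
      refine ⟨t, ?_⟩
      refine (QuotientAddGroup.eq (s := (mulBy (LAdic l R R) y).range)).mpr ?_
      refine ⟨w * a, ?_⟩
      rw [hz, hw, mulBy_apply, smul_eq_mul]
      change y * (w * a) = -algebraMap R (LAdic l R R) t + (algebraMap R (LAdic l R R) t + y * w * a)
      ring
    have hker : (q.comp (algebraMap R (LAdic l R R) : R →+ LAdic l R R)).ker = T := by
      ext t
      exact QuotientAddGroup.eq_zero_iff (N := (mulBy (LAdic l R R) y).range) _
    rw [← hker]
    exact Nat.card_congr (QuotientAddGroup.quotientKerEquivOfSurjective _ hq).toEquiv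
  have hle : (mulBy R r).range ≤ T := by
    rintro _ ⟨t, rfl⟩
    exact (hTmem _).mpr ⟨algebraMap _ _ t, by rw [hy, ← map_mul]; rfl⟩
  have hmul := AddSubgroup.relIndex_mul_index hle
  rw [hcard] at hmul
  have hpos : l ^ v * u.natAbs ≠ 0 := mul_ne_zero (pow_pos hl.pos v).ne' hu0
  have hi0 : T.index ≠ 0 := fun h => hpos (by rw [← hmul, h, mul_zero])
  have hr0 : (mulBy R r).range.relIndex T ≠ 0 := fun h => hpos (by rw [← hmul, h, zero_mul])
  rw [← hT]
  apply Nat.dvd_antisymm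
  · have hcop : Nat.Coprime T.index u.natAbs := by
      rw [Nat.coprime_comm]
      refine Nat.Coprime.symm (Nat.coprime_of_dvd fun p hp h1 h2 => ?_)
      have : Finite (R ⧸ T) := Nat.finite_of_card_ne_zero hi0
      have h3 : p ∣ l ^ v := by
        refine prime_dvd_of_forall_nsmul_eq_zero (A := R ⧸ T) hp (fun a => ?_) h1
        obtain ⟨a, rfl⟩ := QuotientAddGroup.mk'_surjective _ a
        rw [← map_nsmul]
        refine (QuotientAddGroup.eq_zero_iff (N := T) _).mpr ?_
        rw [hTmem]
        obtain ⟨w, hw⟩ := hdvd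
        refine ⟨w * algebraMap _ _ a, ?_⟩
        rw [← mul_assoc, ← hw, nsmul_eq_mul, map_mul]
        simp
      rw [(Nat.prime_dvd_prime_iff_eq hp hl).mp (hp.dvd_of_dvd_pow h3)] at h2
      exact hlu h2
    exact hcop.dvd_of_dvd_mul_right ⟨_, by rw [← hmul, mul_comm]⟩
  · have hcop : Nat.Coprime (l ^ v) ((mulBy R r).range.relIndex T) := by
      apply Nat.Coprime.pow_left
      rw [Nat.Prime.coprime_iff_not_dvd hl]
      intro h
      have : Finite (T ⧸ (mulBy R r).range.addSubgroupOf T) := Nat.finite_of_card_ne_zero hr0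
      refine hlu (prime_dvd_of_forall_nsmul_eq_zero
        (A := T ⧸ (mulBy R r).range.addSubgroupOf T) hl (fun a => ?_) h)
      obtain ⟨⟨a, ha⟩, rfl⟩ := QuotientAddGroup.mk'_surjective _ a
      rw [← map_nsmul]
      refine (QuotientAddGroup.eq_zero_iff (N := (mulBy R r).range.addSubgroupOf T) _).mpr ?_
      rw [AddSubgroup.mem_addSubgroupOf]
      change u.natAbs • a ∈ (mulBy R r).range
      suffices hz : u * a ∈ (mulBy R r).range by
        rcases Int.natAbs_eq u with h | h
        · rw [nsmul_eq_mul, ← Int.cast_natCast, ← h]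
          exact hz
        · rw [← neg_mem_iff, nsmul_eq_mul, ← Int.cast_natCast, ← neg_mul, ← Int.cast_neg, ← h]
          exact hz
      obtain ⟨b, hb⟩ := (hTmem _).mp ha
      obtain ⟨t, b', hb'⟩ := LAdic.exists_eq_algebraMap_add b v
      have h1 : algebraMap R (LAdic l R R) (a - r * t) = (l : LAdic l R R) ^ v * (y * b') := by
        rw [map_sub, map_mul, ← hy, ← hb, hb']
        ring
      obtain ⟨a', ha'⟩ := LAdic.exists_eq_mul h1
      refine ⟨s * a' + u * t, ?_⟩
      rw [mulBy_apply, smul_eq_mul, mul_add, ← mul_assoc, hrs, eq_add_of_sub_eq ha']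
      ring
    exact hcop.dvd_of_dvd_mul_left ⟨_, hmul⟩

end Order

/-! ### Arithmetic of supersingular numbers -/

section Supersingular

open Polynomial

lemma not_isSquare_prime_pow {p k : ℕ} (hp : p.Prime) (hk : Odd k) : ¬ IsSquare (p ^ k) := by
  rintro ⟨r, hr⟩
  obtain ⟨i, -, hi⟩ := (Nat.dvd_prime_pow hp).mp (Dvd.intro_left r hr.symm)
  rw [hi, ← pow_add] at hr
  have := Nat.pow_right_injective hp.two_le hr
  exact (Nat.not_even_iff_odd.mpr hk) ⟨i, this⟩

lemma odd_eval_geom_sum {D : ℤ} (hD : Odd D) {n m : ℕ} (hn : Odd n) :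
    Odd ((∑ i ∈ Finset.range n, (X ^ m) ^ i * (C D) ^ (n - 1 - i) : ℤ[X]).eval 1) := by
  have h : (∑ i ∈ Finset.range n, (X ^ m) ^ i * (C D) ^ (n - 1 - i) : ℤ[X]).eval 1 =
      ∑ i ∈ Finset.range n, D ^ (n - 1 - i) := by
    simp [eval_finsetSum]
  rw [h, ← ZMod.intCast_eq_one_iff_odd]
  push_cast
  rw [hD.intCast_zmod_two]
  simpa using hn.natCast_zmod_two

/-- The number α is a root of X^(mn) - D^n but not of its factor X^m - D, so it is a root of the
cofactor. -/
lemma dvd_geom_sum_of_pow_eq {α : ℂ} {F : ℤ[X]} (hmin : ∀ P : ℤ[X], aeval α P = 0 → F ∣ P)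
    {D : ℤ} {n m : ℕ} (h : (α ^ m) ^ n = (D : ℂ) ^ n) (hne : α ^ m ≠ D) :
    F ∣ ∑ i ∈ Finset.range n, (X ^ m) ^ i * (C D) ^ (n - 1 - i) := by
  apply hmin
  have h1 := geom_sum₂_mul (α ^ m) (D : ℂ) n
  rw [h, sub_self] at h1
  rcases mul_eq_zero.mp h1 with h2 | h2
  · rw [← h2]
    simp
  · exact absurd (sub_eq_zero.mp h2) hne

/-- The exponent 2m kills both the root of unity and the square root; the second claim compares
absolute values. -/
lemma IsSupersingularNumber.exists_pow_eq {q : ℕ} {α : ℂ} (hα : IsSupersingularNumber q α) :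
    (∃ n : ℕ, 0 < n ∧ ∃ B : ℤ, α ^ n = B) ∧ ∀ (n : ℕ) (B : ℤ), α ^ n = B → B ^ 2 = (q : ℤ) ^ n := by
  obtain ⟨ζ, m, hm, hζ, rfl⟩ := hα
  have hsq : ((Real.sqrt (q : ℝ) : ℂ)) ^ 2 = q := by
    rw [← Complex.ofReal_pow, Real.sq_sqrt (Nat.cast_nonneg q)]
    simp
  refine ⟨⟨2 * m, by omega, (q : ℤ) ^ m, ?_⟩, ?_⟩
  · rw [mul_pow, mul_comm 2 m, pow_mul ζ, hζ, one_pow, one_mul, mul_comm m 2, pow_mul, hsq]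
    push_cast
    rfl
  · intro n B h
    have hn : ‖ζ‖ = 1 := Complex.norm_eq_one_of_pow_eq_one hζ hm.ne'
    have h1 := congrArg (fun z : ℂ => ‖z‖ ^ 2) h
    simp only [norm_pow, norm_mul, hn, one_mul, Complex.norm_real, Complex.norm_intCast,
      sq_abs] at h1
    rw [Real.norm_of_nonneg (Real.sqrt_nonneg _), ← pow_mul, mul_comm n 2, pow_mul,
      Real.sq_sqrt (Nat.cast_nonneg q)] at h1
    exact_mod_cast h1.symm

lemma eq_sign_mul_prime_pow {p k n : ℕ} (hp : p.Prime) {B : ℤ} (h : B ^ 2 = ((p ^ k : ℕ) : ℤ) ^ n) :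
    ∃ (ε : ℤ) (j : ℕ), (ε = 1 ∨ ε = -1) ∧ B = ε * (p : ℤ) ^ j ∧ 2 * j = k * n := by
  have h1 : B.natAbs ^ 2 = p ^ (k * n) := by
    have := congrArg Int.natAbs h
    rw [Int.natAbs_pow, Int.natAbs_pow, Int.natAbs_natCast, ← pow_mul] at this
    exact this
  obtain ⟨j, -, hj⟩ := (Nat.dvd_prime_pow hp).mp (Dvd.intro_left _ ((sq _).symm.trans h1))
  rw [hj, ← pow_mul] at h1
  have h2 := Nat.pow_right_injective hp.two_le h1
  rcases Int.natAbs_eq B with hB | hB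
  · exact ⟨1, j, Or.inl rfl, by rw [hB, hj]; push_cast; ring, by omega⟩
  · exact ⟨-1, j, Or.inr rfl, by rw [hB, hj]; push_cast; ring, by omega⟩

/-- Away from the exceptional case, the minimal polynomial `F` of a supersingular number is
either nonzero at `1` modulo `l`, or it takes a value exactly divisible by `l` at some
integer congruent to `1` modulo `l`. -/
lemma exists_eval_of_not_isExceptional {p k q : ℕ} (hp : p.Prime) (hk : 0 < k) (hq : q = p ^ k)
    {α : ℂ} (hα : IsSupersingularNumber q α) {l : ℕ} (hl : l.Prime) (hlp : l ≠ p) {F : ℤ[X]}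
    (hmin : ∀ P : ℤ[X], aeval α P = 0 → F ∣ P) (hex : ¬ IsExceptional p q l α) :
    F.eval 1 ≠ 0 ∧ (¬ (l : ℤ) ∣ F.eval 1 ∨
      ∃ c : ℤ, (l : ℤ) ∣ c - 1 ∧ (l : ℤ) ∣ F.eval c ∧ ¬ (l : ℤ) ^ 2 ∣ F.eval c) := by
  classical
  obtain ⟨hexists, hsq⟩ := hα.exists_pow_eq
  have hN := Nat.find_spec hexists
  have hNmin : ∀ m, 0 < m → m < Nat.find hexists → ∀ B : ℤ, α ^ m ≠ B :=
    fun m hm hlt B hB => Nat.find_min hexists hlt ⟨hm, B, hB⟩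
  set N := Nat.find hexists
  obtain ⟨hN0, B, hB⟩ := hN
  obtain ⟨ε, j, hε, hBj, hj⟩ := eq_sign_mul_prime_pow hp (hq ▸ hsq N B hB)
  have hj0 : 0 < j := by
    have := Nat.mul_pos hk hN0
    omega
  have hlP : Prime (l : ℤ) := Nat.prime_iff_prime_int.mp hl
  have hlp' : ¬ (l : ℤ) ∣ p := by
    rw [Int.natCast_dvd_natCast, Nat.prime_dvd_prime_iff_eq hl hp]
    exact hlp
  have hdvd : F ∣ X ^ N - C B := hmin _ (by simp [hB])
  obtain ⟨G, hG⟩ := hdvd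
  have hG1 : 1 - B = F.eval 1 * G.eval 1 := by
    have := congrArg (eval 1) hG
    simpa using this
  have hB1 : B ≠ 1 := by
    intro h1
    have h2 : (1 : ℤ) < (p : ℤ) ^ j := one_lt_pow₀ (by exact_mod_cast hp.one_lt) hj0.ne'
    rcases hε with rfl | rfl <;> linarith
  have hF1 : F.eval 1 ≠ 0 := by
    intro h
    rw [h, zero_mul] at hG1
    exact hB1 (by linarith)
  refine ⟨hF1, ?_⟩
  by_cases hlF : (l : ℤ) ∣ F.eval 1
  swap
  · exact Or.inl hlF
  right
  by_cases hlN : l ∣ N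
  swap
  · by_cases h2 : (l : ℤ) ^ 2 ∣ F.eval 1
    swap
    · exact ⟨1, by simp, hlF, h2⟩
    -- The derivative of X^N - B at 1 is N, prime to l, so F'(1) is prime to l. Then F(1 + l) ≡ F(1)
    -- + l F'(1) modulo l^2 is not divisible by l^2 when F(1) is.
    have hder := congrArg (fun P => eval 1 (derivative P)) hG
    simp only [derivative_sub, derivative_X_pow, derivative_C, sub_zero, derivative_mul, eval_add,
      eval_mul, eval_C, eval_pow, eval_X, one_pow, mul_one] at hder
    have hF' : ¬ (l : ℤ) ∣ (derivative F).eval 1 := by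
      intro h
      apply hlN
      rw [← Int.natCast_dvd_natCast]
      have : (N : ℤ) = eval 1 (derivative F) * eval 1 G + eval 1 F * eval 1 (derivative G) := by
        simpa using hder
      rw [this]
      exact dvd_add (h.mul_right _) (hlF.mul_right _)
    obtain ⟨z, hz⟩ := F.binomExpansion 1 (l : ℤ)
    refine ⟨1 + l, by simp, ?_, ?_⟩
    · rw [hz]
      exact dvd_add (dvd_add hlF (dvd_mul_left _ _)) ((dvd_pow_self _ two_ne_zero).mul_left _)
    · intro h
      rw [hz, dvd_add_left (dvd_mul_left _ _), dvd_add_right h2, sq] at h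
      exact hF' ((mul_dvd_mul_iff_right hlP.ne_zero).mp h)
  obtain ⟨n, hn⟩ := hlN
  have hn0 : 0 < n := by
    rcases Nat.eq_zero_or_pos n with h | h
    · rw [h, mul_zero] at hn; omega
    · exact h
  have hnN : n < N := by rw [hn]; exact lt_mul_left hn0 hl.one_lt
  refine ⟨1, by simp, hlF, fun h4 => ?_⟩
  rcases hl.eq_two_or_odd' with rfl | hodd
  · have hpodd : p % 2 = 1 := hp.eq_two_or_odd.resolve_left (Ne.symm hlp)
    have hj' : j = k * n := by
      rw [hn] at hj
      have : 2 * j = 2 * (k * n) := by rw [hj]; ring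
      omega
    have h4B : (4 : ℤ) ∣ 1 - B := by
      rw [hG1]
      exact Dvd.dvd.mul_right (by simpa using h4) _
    have hp4 : (p : ℤ) % 4 = 1 ∨ (p : ℤ) % 4 = 3 := by omega
    have hp2 : (p : ℤ) ^ 2 ≡ 1 [ZMOD 4] := by
      rcases hp4 with h | h
      · exact Int.ModEq.pow 2 (show (p : ℤ) ≡ 1 [ZMOD 4] from h)
      · exact Int.ModEq.pow 2 (show (p : ℤ) ≡ 3 [ZMOD 4] from h)
    have hp2i : ∀ i : ℕ, (p : ℤ) ^ (2 * i) ≡ 1 [ZMOD 4] := by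
      intro i
      simpa [pow_mul] using hp2.pow i
    -- For even j, the sign + would give π^n = ±p^(j/2) against the minimality of N, and the sign -
    -- would give 1 - B ≡ 2 mod 4.
    have hjodd : Odd j := by
      rw [← Nat.not_even_iff_odd]
      rintro ⟨i, hi⟩
      rcases hε with rfl | rfl
      · have h1 : (α ^ n) ^ 2 = ((p : ℂ) ^ i) ^ 2 := by
          rw [← pow_mul, mul_comm n 2, ← hn, hB, hBj, hi]
          push_cast
          ring
        rcases sq_eq_sq_iff_eq_or_eq_neg.mp h1 with h | h
        · exact hNmin n hn0 hnN ((p : ℤ) ^ i) (by rw [h]; push_cast; rfl)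
        · exact hNmin n hn0 hnN (-(p : ℤ) ^ i) (by rw [h]; push_cast; rfl)
      · have h1 : ((p : ℤ) ^ j) % 4 = 1 := by
          rw [hi, ← two_mul]
          exact hp2i i
        rw [hBj] at h4B
        omega
    have hkn := Nat.odd_mul.mp (hj' ▸ hjodd)
    have hpj : ((p : ℤ) ^ j) % 4 = (p : ℤ) % 4 := by
      obtain ⟨i, hi⟩ := hjodd
      rw [hi, pow_succ]
      have := (hp2i i).mul_right (p : ℤ)
      rw [one_mul] at this
      exact this
    -- From B = ε p^j ≡ 1 and p^j ≡ p modulo 4 it follows that ε ≡ p mod 4.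
    have hjac : jacobiSym (-1) p = ε := by
      rw [jacobiSym.at_neg_one (Nat.odd_iff.mpr hpodd)]
      rcases hε with rfl | rfl
      · exact ZMod.χ₄_nat_one_mod_four (by omega)
      · exact ZMod.χ₄_nat_three_mod_four (by omega)
    have hεn : ε ^ n = ε := by
      rcases hε with rfl | rfl
      · simp
      · exact hkn.2.neg_one_pow
    -- This is the only use of non-exceptionality. Since α^(2n) = (εq)^n, F divides the cofactor of
    -- X^2 - εq, whose value at 1 is a sum of n odd terms with n odd; this contradicts 2 ∣ F(1).
    have hne : α ^ 2 ≠ ((ε * q : ℤ) : ℂ) := by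
      intro h
      refine hex ⟨rfl, hq ▸ not_isSquare_prime_pow hp hkn.1, ?_⟩
      rw [h, hjac]
      push_cast
      rfl
    have hpow : (α ^ 2) ^ n = ((ε * q : ℤ) : ℂ) ^ n := by
      rw [← pow_mul, ← hn, hB, hBj, hj', hq, ← Int.cast_pow, mul_pow, hεn]
      push_cast
      rw [← pow_mul]
    have hFd := dvd_geom_sum_of_pow_eq hmin hpow hne
    have hqodd : Odd (ε * q : ℤ) := by
      apply Odd.mul
      · rcases hε with rfl | rfl <;> decide
      · rw [hq]
        push_cast
        apply Odd.pow
        rw [Int.odd_iff]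
        omega
    obtain ⟨W, hW⟩ := hFd
    have := odd_eval_geom_sum (m := 2) hqodd hkn.2
    rw [hW, eval_mul, Int.odd_mul] at this
    rw [← Int.not_even_iff_odd, even_iff_two_dvd] at this
    exact this.1 (by simpa using hlF)
  -- For odd l, the relation 2j = k l n makes B an l-th power b^l. Minimality of N excludes α^n = b,
  -- so F divides (X^N - b^l)/(X^n - b).
  · have hlj : l ∣ j := by
      have h1 : l ∣ 2 * j := by
        rw [hj, hn]
        exact (dvd_mul_right l n).mul_left k
      rcases (Nat.Prime.dvd_mul hl).mp h1 with h | h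
      · rw [Nat.prime_dvd_prime_iff_eq hl Nat.prime_two] at h
        rw [h] at hodd
        exact absurd hodd (by decide)
      · exact h
    obtain ⟨i, hi⟩ := hlj
    have hBl : B = (ε * (p : ℤ) ^ i) ^ l := by
      rw [hBj, mul_pow, ← pow_mul, mul_comm i l, ← hi]
      congr 1
      rcases hε with rfl | rfl
      · simp
      · exact hodd.neg_one_pow.symm
    set b := ε * (p : ℤ) ^ i with hb
    have hpow : (α ^ n) ^ l = (b : ℂ) ^ l := by
      rw [← pow_mul, mul_comm n l, ← hn, hB, hBl]
      push_cast
      rfl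
    obtain ⟨W, hW⟩ := dvd_geom_sum_of_pow_eq hmin hpow (hNmin n hn0 hnN b)
    have hval := congrArg (eval 1) hW
    rw [eval_finsetSum, eval_mul] at hval
    simp only [eval_mul, eval_pow, eval_X, eval_C, one_pow] at hval
    have hb1 : (l : ℤ) ∣ b - 1 := by
      have h1 : (l : ℤ) ∣ 1 - b ^ l := by
        rw [← hBl, hG1]
        exact hlF.mul_right _
      have : Fact l.Prime := ⟨hl⟩
      rw [← ZMod.intCast_zmod_eq_zero_iff_dvd] at h1 ⊢
      push_cast at h1 ⊢
      rw [ZMod.pow_card] at h1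
      linear_combination -h1
    obtain ⟨t, ht⟩ := hb1
    -- Since b ≡ 1 mod l, the cofactor at 1 is congruent to l b^(l-1) modulo l^2, and b is prime to
    -- l.
    have hs := odd_sq_dvd_geom_sum₂_sub (a := b) (b := -t) hodd
    have hone : b + (l : ℤ) * -t = 1 := by linear_combination ht
    rw [hone] at hs
    simp only [one_pow] at hs
    rw [hval] at hs
    rw [dvd_sub_right (h4.mul_right _), sq] at hs
    have hlb := hlP.dvd_of_dvd_pow ((mul_dvd_mul_iff_left hlP.ne_zero).mp hs)
    rw [hb] at hlb
    rcases hlP.dvd_or_dvd hlb with h | h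
    · rcases hε with rfl | rfl
      · exact hlP.not_isUnit (isUnit_of_dvd_one h)
      · exact hlP.not_isUnit (isUnit_of_dvd_one (by simpa using h))
    · exact hlp' (hlP.dvd_of_dvd_pow h)

end Supersingular

/-! ### Generators of the reduction of a lattice over a completed order -/

section Generators

open Polynomial

/-- A maximal ideal above I with the same finite index must coincide with I. -/
lemma Ideal.isMaximal_of_index_eq {A : Type*} [CommRing A] {I : Ideal A}
    (h1 : I.toAddSubgroup.index ≠ 1) (h0 : I.toAddSubgroup.index ≠ 0)
    (h : ∀ P : Ideal A, P.IsMaximal → I ≤ P → P.toAddSubgroup.index = I.toAddSubgroup.index) :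
    I.IsMaximal := by
  have hne : I ≠ ⊤ := by
    rintro rfl
    exact h1 AddSubgroup.index_top
  obtain ⟨P, hP, hIP⟩ := Ideal.exists_le_maximal I hne
  have hle : I.toAddSubgroup ≤ P.toAddSubgroup := hIP
  have hmul := AddSubgroup.relIndex_mul_index hle
  rw [h P hP hIP] at hmul
  have h2 : I.toAddSubgroup.relIndex P.toAddSubgroup = 1 :=
    Nat.eq_of_mul_eq_mul_right (Nat.pos_of_ne_zero h0) (by rw [hmul, one_mul])
  have h3 : P ≤ I := AddSubgroup.relIndex_eq_one.mp h2
  rw [le_antisymm hIP h3]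
  exact hP

lemma Ideal.isMaximal_of_index_prime {A : Type*} [CommRing A] {I : Ideal A}
    (h : I.toAddSubgroup.index.Prime) : I.IsMaximal := by
  refine Ideal.isMaximal_of_index_eq h.one_lt.ne' h.pos.ne' fun P hP hIP => ?_
  have hle : I.toAddSubgroup ≤ P.toAddSubgroup := hIP
  refine ((Nat.dvd_prime h).mp (AddSubgroup.index_dvd_of_le hle)).resolve_left fun h1 => ?_
  rw [AddSubgroup.index_eq_one] at h1
  apply hP.ne_top
  rw [Ideal.eq_top_iff_one]
  change (1 : A) ∈ P.toAddSubgroup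
  rw [h1]
  trivial

lemma index_span_singleton {A : Type*} [CommRing A] (y : A) :
    (Ideal.span {y}).toAddSubgroup.index = (mulBy A y).range.index :=
  card_quotient_span y

lemma exists_sub_mul_eq_eval {A : Type*} [CommRing A] {θ : A} {F : ℤ[X]} (hF : aeval θ F = 0)
    (c : ℤ) : ∃ s : A, (θ - c) * s = (F.eval c : ℤ) := by
  obtain ⟨Q, hQ⟩ : X - C c ∣ F - C (F.eval c) := by
    rw [dvd_iff_isRoot]
    simp
  have h := congrArg (aeval θ) hQ
  rw [map_sub, map_mul, hF] at h
  simp only [map_sub, aeval_X, eq_intCast, map_intCast] at h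
  exact ⟨-aeval θ Q, by rw [mul_neg, ← h]; ring⟩

lemma Int.exists_eq_prime_pow_mul {l : ℕ} (hl : l.Prime) {a : ℤ} (ha : a ≠ 0) :
    ∃ (v : ℕ) (u : ℤ), a = (l : ℤ) ^ v * u ∧ ¬ (l : ℤ) ∣ u := by
  have hf : FiniteMultiplicity (l : ℤ) a := by
    rw [Int.finiteMultiplicity_iff]
    exact ⟨by simpa using hl.one_lt.ne', ha⟩
  obtain ⟨u, h1, h2⟩ := hf.exists_eq_pow_mul_and_not_dvd
  exact ⟨_, u, h1, h2⟩

/-- An order `R` with an element `θ` generating it up to finite index, and a generator `F` of the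
ideal of integral relations of `θ`. -/
structure IsGenerator (R : Type*) [CommRing R] (θ : R) (F : ℤ[X]) : Prop where
  aeval_eq_zero : aeval θ F = 0
  dvd : ∀ P : ℤ[X], aeval θ P = 0 → F ∣ P
  exists_smul_eq : ∀ r : R, ∃ (d : ℤ) (P : ℤ[X]), d ≠ 0 ∧ d • r = aeval θ P

variable {l : ℕ} {R : Type*} [CommRing R] {θ : R} {F : ℤ[X]}

lemma LAdic.sub_dvd_pow (hΛ : IsAdicOrder l (LAdic l R R)) (hF : aeval θ F = 0) {c : ℤ} {v : ℕ}
    {u : ℤ} (hv : F.eval c = (l : ℤ) ^ v * u) (hu : ¬ (l : ℤ) ∣ u) :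
    algebraMap R (LAdic l R R) (θ - c) ∣ (l : LAdic l R R) ^ v := by
  obtain ⟨s, hs⟩ := exists_sub_mul_eq_eval hF c
  rw [hv] at hs
  push_cast at hs
  have h := congrArg (algebraMap R (LAdic l R R)) hs
  rw [map_mul, map_mul, map_pow, map_natCast, map_intCast] at h
  obtain ⟨w, hw⟩ := (hΛ.isUnit_intCast hu).exists_right_inv
  refine ⟨algebraMap R (LAdic l R R) s * w, ?_⟩
  rw [← mul_assoc, h, mul_assoc, hw, mul_one]

lemma LAdic.index_sub [IsDomain R] [CharZero R] [Module.Finite ℤ R]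
    (hΛ : IsAdicOrder l (LAdic l R R)) (hθ : IsGenerator R θ F) {c : ℤ} {v : ℕ}
    {u : ℤ} (hv : F.eval c = (l : ℤ) ^ v * u) (hu : ¬ (l : ℤ) ∣ u) :
    (mulBy (LAdic l R R) (algebraMap R (LAdic l R R) (θ - c))).range.index = l ^ v := by
  have hne : F.eval c ≠ 0 := by
    rw [hv]
    refine mul_ne_zero (pow_ne_zero _ (by exact_mod_cast hΛ.prime.ne_zero)) ?_
    rintro rfl
    exact hu (dvd_zero _)
  obtain ⟨s, hs⟩ := exists_sub_mul_eq_eval hθ.aeval_eq_zero c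
  refine LAdic.index_range_mulBy hΛ.prime hu (hΛ.isUnit_intCast hu) (s := s) ?_ ?_
  · rw [hs, hv]
    push_cast
    rfl
  · rw [index_range_mulBy_sub_intCast hθ.aeval_eq_zero hθ.dvd hθ.exists_smul_eq hne, hv,
      Int.natAbs_mul, Int.natAbs_pow, Int.natAbs_natCast]

variable {M : Type*} [AddCommGroup M] [Module (LAdic l R R) M] {e : ℕ}

/-- By `LAdic.index_sub` the ideal generated by θ - c has index exactly l, hence is maximal. -/
lemma IsLattice.spannedMod_sub [IsDomain R] [CharZero R] [Module.Finite ℤ R]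
    (hΛ : IsAdicOrder l (LAdic l R R)) (hθ : IsGenerator R θ F)
    (hM : IsLattice l (LAdic l R R) M e) {c : ℤ} (h1 : (l : ℤ) ∣ F.eval c)
    (h2 : ¬ (l : ℤ) ^ 2 ∣ F.eval c) :
    SpannedMod e (algebraMap R (LAdic l R R) (θ - c)) M := by
  obtain ⟨u, hu⟩ := h1
  have hlu : ¬ (l : ℤ) ∣ u := by
    rintro ⟨w, rfl⟩
    exact h2 ⟨w, by rw [hu]; ring⟩
  have hv : F.eval c = (l : ℤ) ^ 1 * u := by rw [hu, pow_one]
  refine hM.spannedMod_of_isMaximal hΛ (LAdic.sub_dvd_pow hΛ hθ.aeval_eq_zero hv hlu) ?_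
  apply Ideal.isMaximal_of_index_prime
  rw [index_span_singleton, LAdic.index_sub hΛ hθ hv hlu, pow_one]
  exact hΛ.prime

lemma SpannedMod.of_isUnit {Λ : Type*} [CommRing Λ] {M : Type*} [AddCommGroup M] [Module Λ M]
    (e : ℕ) {x : Λ} (hx : IsUnit x) : SpannedMod e x M := by
  obtain ⟨w, hw⟩ := hx.exists_right_inv
  exact ⟨0, fun m => ⟨0, w • m, by simp [smul_smul, hw]⟩⟩

/-- If `F(1) ≠ 0` and `F` has the Dedekind property at `1` modulo `l`, the reduction of a lattice
modulo `θ - 1` is free. -/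
lemma IsLattice.modBy_sub_one_equiv [IsDomain R] [CharZero R] [Module.Finite ℤ R]
    (hΛ : IsAdicOrder l (LAdic l R R)) (hθ : IsGenerator R θ F)
    (hM : IsLattice l (LAdic l R R) M e) (hF1 : F.eval 1 ≠ 0)
    (hF : ¬ (l : ℤ) ∣ F.eval 1 ∨
      ∃ c : ℤ, (l : ℤ) ∣ c - 1 ∧ (l : ℤ) ∣ F.eval c ∧ ¬ (l : ℤ) ^ 2 ∣ F.eval c)
    {x : LAdic l R R} (hx : x = algebraMap R (LAdic l R R) (θ - 1)) :
    Nonempty (ModBy x M ≃ₗ[LAdic l R R] (Fin e → LAdic l R R ⧸ Ideal.span {x})) := by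
  have hx' : x = algebraMap R (LAdic l R R) (θ - (1 : ℤ)) := by rw [hx, Int.cast_one]
  obtain ⟨v, u, hv, hu⟩ := Int.exists_eq_prime_pow_mul hΛ.prime hF1
  have hdvd : x ∣ (l : LAdic l R R) ^ v := hx' ▸ LAdic.sub_dvd_pow hΛ hθ.aeval_eq_zero hv hu
  refine hM.modBy_equiv hΛ hdvd ?_
  rcases hF with hF | ⟨c, ⟨t, ht⟩, h1, h2⟩
  · apply SpannedMod.of_isUnit
    have h := LAdic.sub_dvd_pow hΛ hθ.aeval_eq_zero (c := 1) (v := 0) (u := F.eval 1) (by simp) hF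
    rw [← hx', pow_zero] at h
    exact isUnit_of_dvd_one h
  -- With c = 1 + l t, θ - c is congruent to -l t modulo x. Its v-th power is therefore divisible by
  -- x modulo a multiple of l^v, which x divides too.
  · refine ((hM.spannedMod_sub hΛ hθ h1 h2).pow v).of_dvd ?_
    set y := algebraMap R (LAdic l R R) (θ - c) with hy
    have hyx : y = x + (l : LAdic l R R) * (-t : ℤ) := by
      have hc : c = 1 + l * t := by linear_combination ht
      rw [hy, hx, hc]
      push_cast
      simp only [map_intCast]
      ring
    have h3 : x ∣ y ^ v - ((l : LAdic l R R) * (-t : ℤ)) ^ v := by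
      refine dvd_trans ?_ (sub_dvd_pow_sub_pow _ _ v)
      rw [hyx, add_sub_cancel_right]
    rw [mul_pow] at h3
    exact (dvd_sub_left (hdvd.mul_right _)).mp h3

end Generators

/-! ### Reductions of lattices as abelian `2`-groups -/

section TwoGroup

/-- The numerical constraints satisfied by the reductions below determine all the indices. -/
lemma exists_nsmulIndex_eq {G : Type*} [AddCommGroup G] [Finite G] {n e : ℕ} (hn : 2 ≤ n)
    (hG : ∀ g : G, 2 ^ n • g = 0) (hcard : nsmulIndex (2 ^ n) G = 2 ^ (n * e))
    (hsymm : 4 ^ e * nsmulIndex (2 ^ (n - 1)) G = 2 ^ (n * e) * nsmulIndex (2 ^ 1) G)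
    (hfour : 3 ≤ n → nsmulIndex (2 ^ 2) G = 2 ^ e * nsmulIndex (2 ^ 1) G) :
    ∃ f : ℕ, e ≤ f ∧ f ≤ 2 * e ∧
      ∀ i, 1 ≤ i → i < n → nsmulIndex (2 ^ i) G = 2 ^ (f + (i - 1) * e) := by
  obtain ⟨ι, _, k, hk0, hkn, ⟨φ⟩⟩ := exists_addEquiv_pi_zmod_pow Nat.prime_two G hG
  have hidx : ∀ i, nsmulIndex (2 ^ i) G = 2 ^ ∑ j, min (k j) i := fun i => by
    rw [nsmulIndex_congr φ, nsmulIndex_pi_zmod_pow Nat.prime_two]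
  have hinj := Nat.pow_right_injective (le_refl 2)
  set s : ℕ → ℕ := fun i => ∑ j, min (k j) i with hs
  have hstep : ∀ i, s (i + 1) = s i + (Finset.univ.filter fun j => i < k j).card := sum_min_succ k
  have hanti : ∀ i i', i ≤ i' → (Finset.univ.filter fun j => i' < k j).card ≤
      (Finset.univ.filter fun j => i < k j).card := by
    intro i i' hii
    refine Finset.card_le_card fun j => ?_
    simp only [Finset.mem_filter, Finset.mem_univ, true_and]
    omega
  have hs0 : s 0 = 0 := by simp [hs]
  have e1 : s n = n * e := hinj (by simp only; rw [← hidx, hcard])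
  have e2 : 2 * e + s (n - 1) = n * e + s 1 := by
    apply hinj
    simp only
    rw [pow_add, pow_add, ← hidx, ← hidx, ← hsymm, pow_mul]
    norm_num
  have e3 : 3 ≤ n → s 2 = e + s 1 := by
    intro h
    apply hinj
    simp only
    rw [pow_add, ← hidx, ← hidx, hfour h]
  have hlast := hstep (n - 1)
  rw [Nat.sub_add_cancel (by omega)] at hlast
  have hfirst := hstep 0
  rw [hs0, zero_add, zero_add] at hfirst
  have h0n := hanti 0 (n - 1) (by omega)
  refine ⟨s 1, by omega, by omega, fun i hi hin => ?_⟩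
  rw [hidx]
  congr 1
  change s i = _
  -- The increments of s are non-increasing and s 2 - s 1 = e, so each is at most e from 1 on. As s
  -- (n - 1) - s 1 = (n - 2) e, all of them equal e.
  have hgrow : 3 ≤ n → ∀ i d, 1 ≤ i → s (i + d) ≤ s i + d * e := by
    intro h3 i d hi
    induction d with
    | zero => simp
    | succ d ih =>
      have h1 := hstep (i + d)
      have h2 := hanti 1 (i + d) (by omega)
      have h4 := hstep 1
      have h5 := e3 h3
      rw [← add_assoc, h1, add_mul, one_mul]
      norm_num at h4
      omega
  rcases Nat.lt_or_ge n 3 with h3 | h3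
  · have : i = 1 := by omega
    subst this
    simp
  · have g1 := hgrow h3 1 (i - 1) le_rfl
    have g2 := hgrow h3 i (n - 1 - i) hi
    rw [show 1 + (i - 1) = i by omega] at g1
    rw [show i + (n - 1 - i) = n - 1 by omega] at g2
    have g3 : n * e = 2 * e + (i - 1) * e + (n - 1 - i) * e := by
      rw [← add_mul, ← add_mul]
      congr 1
      omega
    omega

variable {Λ : Type*} [CommRing Λ] {M : Type*} [AddCommGroup M] [Module Λ M] {e : ℕ}

lemma nsmulIndex_modBy (n : ℕ) (z : Λ) :
    nsmulIndex n (ModBy z M) = ((mulBy M z).range ⊔ (mulBy M (n : Λ)).range).index := by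
  let q : M →+ ModBy z M := (LinearMap.range (LinearMap.lsmul Λ M z)).mkQ.toAddMonoidHom
  have hq : Function.Surjective q := Submodule.mkQ_surjective _
  rw [nsmulIndex, ← AddSubgroup.index_comap_of_surjective _ hq]
  congr 1
  ext m
  rw [AddSubgroup.mem_comap, AddSubgroup.mem_sup]
  constructor
  · rintro ⟨g, hg⟩
    obtain ⟨a, rfl⟩ := hq g
    have h1 : m - n • a ∈ LinearMap.range (LinearMap.lsmul Λ M z) := by
      rw [← Submodule.Quotient.mk_eq_zero]
      change q (m - n • a) = 0
      rw [map_sub, map_nsmul, ← hg]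
      simp
    obtain ⟨b, hb⟩ := h1
    refine ⟨z • b, ⟨b, rfl⟩, (n : Λ) • a, ⟨a, rfl⟩, ?_⟩
    rw [LinearMap.lsmul_apply] at hb
    rw [hb, Nat.cast_smul_eq_nsmul]
    abel
  · rintro ⟨_, ⟨b, rfl⟩, _, ⟨a, rfl⟩, rfl⟩
    refine ⟨q a, ?_⟩
    have h1 : q (mulBy M z b) = 0 := (Submodule.Quotient.mk_eq_zero _).mpr ⟨b, rfl⟩
    rw [map_add, h1, zero_add, mulBy_apply, Nat.cast_smul_eq_nsmul, map_nsmul]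
    rfl

lemma range_mulBy_sup_le {n : ℕ} {y z : Λ} (h : (n : Λ) ∣ y - z) :
    (mulBy M y).range ⊔ (mulBy M (n : Λ)).range ≤ (mulBy M z).range ⊔ (mulBy M (n : Λ)).range := by
  refine sup_le ?_ le_sup_right
  rintro _ ⟨m, rfl⟩
  obtain ⟨w, hw⟩ := h
  rw [AddSubgroup.mem_sup]
  refine ⟨z • m, ⟨m, rfl⟩, (n : Λ) • w • m, ⟨w • m, rfl⟩, ?_⟩
  rw [smul_smul, ← hw, ← add_smul, add_sub_cancel, mulBy_apply]

lemma range_mulBy_sup_congr {n : ℕ} {y z : Λ} (h : (n : Λ) ∣ y - z) :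
    (mulBy M y).range ⊔ (mulBy M (n : Λ)).range = (mulBy M z).range ⊔ (mulBy M (n : Λ)).range :=
  le_antisymm (range_mulBy_sup_le h) (range_mulBy_sup_le ((dvd_sub_comm).mp h))

lemma nsmulIndex_modBy_congr {n : ℕ} {y z : Λ} (h : (n : Λ) ∣ y - z) :
    nsmulIndex n (ModBy y M) = nsmulIndex n (ModBy z M) := by
  rw [nsmulIndex_modBy, nsmulIndex_modBy, range_mulBy_sup_congr h]

/-- If `z y` is `2 ^ v` up to a unit and `z ≡ y` modulo `2`, then the top layer of `M / zM` is
dual to its bottom layer. -/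
lemma IsLattice.card_mul_nsmulIndex (hM : IsLattice 2 Λ M e) {y z u : Λ}
    {v : ℕ} (hu : IsUnit u) (hzy : z * y = ((2 : ℕ) : Λ) ^ (v + 1) * u)
    (hmod : ((2 : ℕ) : Λ) ∣ z - y) :
    Nat.card (ModBy z M) * nsmulIndex 2 (ModBy z M) =
      (mulBy M ((2 : ℕ) : Λ)).range.index * nsmulIndex (2 ^ v) (ModBy z M) := by
  have hzd : z ∣ ((2 : ℕ) : Λ) ^ (v + 1) := by
    obtain ⟨w, hw⟩ := hu.exists_right_inv
    exact ⟨y * w, by rw [← mul_assoc, hzy, mul_assoc, hw, mul_one]⟩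
  let q : M →+ ModBy z M := (LinearMap.range (LinearMap.lsmul Λ M z)).mkQ.toAddMonoidHom
  have hq : Function.Surjective q := Submodule.mkQ_surjective _
  let q₂ : M →+ ModBy ((2 : ℕ) : Λ) M :=
    (LinearMap.range (LinearMap.lsmul Λ M ((2 : ℕ) : Λ))).mkQ.toAddMonoidHom
  have hq₂ : Function.Surjective q₂ := Submodule.mkQ_surjective _
  -- Since z y = 2^(v+1) u, the equation 2^v m = z a amounts to y m = 2 u a. So 2^v (M/zM) and (yM +
  -- 2M)/2M are quotients of M by the same kernel, and yM + 2M = zM + 2M.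
  let φ : M →+ ModBy z M := (nsmulAddMonoidHom (2 ^ v)).comp q
  let ψ : M →+ ModBy ((2 : ℕ) : Λ) M := q₂.comp (mulBy M y)
  have hφr : φ.range = (nsmulAddMonoidHom (2 ^ v) : ModBy z M →+ ModBy z M).range := by
    rw [AddMonoidHom.range_comp, AddMonoidHom.range_eq_top.mpr hq, ← AddMonoidHom.range_eq_map]
  have hψr : ψ.range.index = nsmulIndex 2 (ModBy z M) := by
    rw [nsmulIndex_modBy, range_mulBy_sup_congr hmod,
      ← AddSubgroup.index_comap_of_surjective _ hq₂]
    congr 1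
    rw [AddMonoidHom.range_comp, AddSubgroup.comap_map_eq]
    congr 1
    ext m
    exact Submodule.Quotient.mk_eq_zero _
  have hker : φ.ker = ψ.ker := by
    ext m
    rw [AddMonoidHom.mem_ker, AddMonoidHom.mem_ker]
    have h1 : φ m = 0 ↔ ∃ a, z • a = ((2 : ℕ) : Λ) ^ v • m := by
      have : φ m = q (((2 : ℕ) : Λ) ^ v • m) := by
        rw [← Nat.cast_pow, Nat.cast_smul_eq_nsmul, map_nsmul]
        rfl
      rw [this]
      exact Submodule.Quotient.mk_eq_zero _
    have h2 : ψ m = 0 ↔ ∃ a, ((2 : ℕ) : Λ) • a = y • m := Submodule.Quotient.mk_eq_zero _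
    rw [h1, h2]
    have hzinj := mulBy_injective_of_dvd (M := M) hM.regular hzd
    constructor
    · rintro ⟨a, ha⟩
      obtain ⟨w, hw⟩ := hu.exists_right_inv
      refine ⟨u • a, hzinj ?_⟩
      simp only [mulBy_apply]
      calc z • ((2 : ℕ) : Λ) • u • a = (((2 : ℕ) : Λ) * u) • (z • a) := by module
        _ = (((2 : ℕ) : Λ) ^ (v + 1) * u) • m := by
          rw [ha, smul_smul]
          congr 1
          ring
        _ = z • y • m := by rw [← hzy, mul_smul]
    · rintro ⟨a, ha⟩
      obtain ⟨w, hw⟩ := hu.exists_right_inv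
      refine ⟨w • a, ?_⟩
      apply IsAdicOrder.mulBy_injective_pow (Λ := Λ) hM.regular 1
      simp only [mulBy_apply, pow_one]
      calc ((2 : ℕ) : Λ) • z • w • a = (z * w) • (((2 : ℕ) : Λ) • a) := by module
        _ = (w * (z * y)) • m := by
          rw [ha, smul_smul]
          congr 1
          ring
        _ = (((2 : ℕ) : Λ) ^ (v + 1) * (u * w)) • m := by
          rw [hzy]
          congr 1
          ring
        _ = ((2 : ℕ) : Λ) • ((2 : ℕ) : Λ) ^ v • m := by
          rw [hw, mul_one, pow_succ', mul_smul]
  have c1 : φ.ker.index = Nat.card φ.range := AddSubgroup.index_ker φ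
  have c2 : ψ.ker.index = Nat.card ψ.range := AddSubgroup.index_ker ψ
  have d1 := AddSubgroup.card_mul_index φ.range
  have d2 := AddSubgroup.card_mul_index ψ.range
  rw [card_modBy] at d2
  rw [hψr] at d2
  rw [hφr] at d1 c1
  change _ * nsmulIndex (2 ^ v) (ModBy z M) = _ at d1
  rw [← d1, ← d2, ← c1, ← c2, hker]
  ring

lemma nsmulIndex_of_forall_eq_zero {G : Type*} [AddCommGroup G] {n : ℕ}
    (h : ∀ g : G, n • g = 0) : nsmulIndex n G = Nat.card G := by
  have : (nsmulAddMonoidHom n : G →+ G).range = ⊥ := by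
    rw [eq_bot_iff]
    rintro _ ⟨g, rfl⟩
    exact h g
  rw [nsmulIndex, this, AddSubgroup.index_bot]

lemma nsmul_modBy_eq_zero {n : ℕ} {z : Λ} (h : z ∣ (n : Λ)) (g : ModBy z M) : n • g = 0 := by
  obtain ⟨m, rfl⟩ := Submodule.Quotient.mk_surjective _ g
  obtain ⟨w, hw⟩ := h
  have : n • (Submodule.Quotient.mk m : ModBy z M) = Submodule.Quotient.mk ((n : Λ) • m) := by
    rw [Nat.cast_smul_eq_nsmul]
    rfl
  rw [this, Submodule.Quotient.mk_eq_zero, hw]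
  exact ⟨w • m, by rw [LinearMap.lsmul_apply, mul_smul]⟩

/-- The reduction of a lattice over `ℤ₂[√D]`, `D ≡ 1 mod 4`, as an abelian group. -/
lemma IsLattice.exists_nsmulIndex_modBy (hΛ : IsAdicOrder 2 Λ) (hM : IsLattice 2 Λ M e) {τ : Λ}
    {D : ℤ} (hτ : τ ^ 2 = D) (hD : D % 4 = 1)
    (hidx : ∀ (c : ℤ) (v : ℕ) (u : ℤ), c ^ 2 - D = 2 ^ v * u → ¬ (2 : ℤ) ∣ u →
      (mulBy Λ (τ - c)).range.index = 2 ^ v)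
    (htwo : (mulBy Λ ((2 : ℕ) : Λ)).range.index = 4) {n : ℕ} {u : ℤ}
    (hn : 1 - D = 2 ^ n * u) (hu : ¬ (2 : ℤ) ∣ u) :
    2 ≤ n ∧ Finite (ModBy (τ - 1) M) ∧ (∀ g : ModBy (τ - 1) M, 2 ^ n • g = 0) ∧
      nsmulIndex (2 ^ n) (ModBy (τ - 1) M) = 2 ^ (n * e) ∧
      ∃ f : ℕ, e ≤ f ∧ f ≤ 2 * e ∧
        ∀ i, 1 ≤ i → i < n → nsmulIndex (2 ^ i) (ModBy (τ - 1) M) = 2 ^ (f + (i - 1) * e) := by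
  have hn2 : 2 ≤ n := by
    by_contra h
    rcases (by omega : n = 0 ∨ n = 1) with rfl | rfl <;> omega
  have hfac : ∀ (c : ℤ) (v : ℕ) (u : ℤ), c ^ 2 - D = 2 ^ v * u →
      (τ - c) * (τ + c) = ((2 : ℕ) : Λ) ^ v * ((-u : ℤ) : Λ) := by
    intro c v u h
    have h1 : (τ - c) * (τ + c) = ((-(c ^ 2 - D) : ℤ) : Λ) := by
      push_cast
      rw [← hτ]
      ring
    rw [h1, h]
    push_cast
    ring
  have hunit : ∀ u : ℤ, ¬ (2 : ℤ) ∣ u → IsUnit ((-u : ℤ) : Λ) := fun u hu =>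
    hΛ.isUnit_intCast (by simpa using hu)
  have hdvd : ∀ (c : ℤ) (v : ℕ) (u : ℤ), c ^ 2 - D = 2 ^ v * u → ¬ (2 : ℤ) ∣ u →
      (τ - c) ∣ ((2 : ℕ) : Λ) ^ v := by
    intro c v u h hu
    obtain ⟨w, hw⟩ := (hunit u hu).exists_right_inv
    exact ⟨(τ + c) * w, by rw [← mul_assoc, hfac c v u h, mul_assoc, hw, mul_one]⟩
  have hcard : ∀ (c : ℤ) (v : ℕ) (u : ℤ), c ^ 2 - D = 2 ^ v * u → ¬ (2 : ℤ) ∣ u →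
      Nat.card (ModBy (τ - c) M) = 2 ^ (v * e) := by
    intro c v u h hu
    rw [card_modBy, hM.index_eq hΛ (hdvd c v u h hu), hidx c v u h hu, pow_mul]
  have htwoM : (mulBy M ((2 : ℕ) : Λ)).range.index = 4 ^ e := by
    rw [hM.index_eq hΛ (v := 1) (by rw [pow_one]), htwo]
  -- The duality is applied to τ - c and its conjugate τ + c, which agree modulo 2.
  have hsymm : ∀ (c : ℤ) (v : ℕ) (u : ℤ), c ^ 2 - D = 2 ^ (v + 1) * u → ¬ (2 : ℤ) ∣ u →
      4 ^ e * nsmulIndex (2 ^ v) (ModBy (τ - c) M) =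
        2 ^ ((v + 1) * e) * nsmulIndex 2 (ModBy (τ - c) M) := by
    intro c v u h hu
    rw [← htwoM, ← hcard c (v + 1) u h hu]
    refine (hM.card_mul_nsmulIndex (hunit u hu) (hfac c (v + 1) u h) ⟨-c, ?_⟩).symm
    push_cast
    ring
  have hn' : (1 : ℤ) ^ 2 - D = 2 ^ n * u := by rw [one_pow, hn]
  have hone : τ - ((1 : ℤ) : Λ) = τ - 1 := by rw [Int.cast_one]
  have hkill : ∀ g : ModBy (τ - 1) M, 2 ^ n • g = 0 := by
    intro g
    apply nsmul_modBy_eq_zero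
    have := hdvd 1 n u hn' hu
    rw [hone] at this
    simpa using this
  have hc1 := hcard 1 n u hn' hu
  rw [hone] at hc1
  have hfin : Finite (ModBy (τ - 1) M) :=
    Nat.finite_of_card_ne_zero (by rw [hc1]; positivity)
  have hcardn : nsmulIndex (2 ^ n) (ModBy (τ - 1) M) = 2 ^ (n * e) := by
    rw [nsmulIndex_of_forall_eq_zero hkill, hc1]
  refine ⟨hn2, hfin, hkill, hcardn, exists_nsmulIndex_eq hn2 hkill hcardn ?_ ?_⟩
  · have h := hsymm 1 (n - 1) u (by rw [Nat.sub_add_cancel (by omega), hn']) hu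
    rw [hone, Nat.sub_add_cancel (by omega)] at h
    rw [h, pow_one]
  · intro h3
    have h8 : (8 : ℤ) ∣ 1 - D := by
      rw [hn]
      exact (pow_dvd_pow (2 : ℤ) h3).mul_right u
    -- As (-3)^2 = 1 + 8, one of c = 1, -3 makes c^2 - D divisible by exactly 8. For that c the
    -- duality compares multiplication by 4 with multiplication by 2, and c ≡ 1 mod 4 transfers the
    -- result back to τ - 1.
    obtain ⟨c, hc4, w, hcw, hw⟩ : ∃ c : ℤ, (4 : ℤ) ∣ c - 1 ∧ ∃ w : ℤ, c ^ 2 - D = 2 ^ (2 + 1) * w ∧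
        ¬ (2 : ℤ) ∣ w := by
      obtain ⟨t, ht⟩ := h8
      by_cases h2 : (2 : ℤ) ∣ t
      · exact ⟨-3, by norm_num, t + 1, by linear_combination ht, by omega⟩
      · exact ⟨1, by norm_num, t, by linear_combination ht, h2⟩
    have h := hsymm c 2 w hcw hw
    obtain ⟨r, hr⟩ := hc4
    have hdiff : (τ - 1) - (τ - c) = ((2 ^ 2 : ℕ) : Λ) * (r : Λ) := by
      have := congrArg (Int.cast : ℤ → Λ) hr
      push_cast at this ⊢
      linear_combination this
    have h4 : nsmulIndex (2 ^ 2) (ModBy (τ - 1) M) = nsmulIndex (2 ^ 2) (ModBy (τ - c) M) :=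
      nsmulIndex_modBy_congr ⟨r, hdiff⟩
    have h2 : nsmulIndex 2 (ModBy (τ - 1) M) = nsmulIndex 2 (ModBy (τ - c) M) :=
      nsmulIndex_modBy_congr ⟨((2 : ℕ) : Λ) * r, by rw [hdiff]; push_cast; ring⟩
    rw [h4, pow_one, h2]
    apply Nat.eq_of_mul_eq_mul_left (show 0 < 4 ^ e by positivity)
    rw [h, ← mul_assoc]
    congr 1
    rw [show (4 : ℕ) = 2 ^ 2 by norm_num, ← pow_mul, ← pow_add]
    congr 1
    ring

end TwoGroup

/-! ### Quadratic generators -/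

section Quadratic

open Polynomial

variable {R : Type*} [CommRing R] {θ : R}

lemma exists_aeval_eq_linear {F : ℤ[X]} (hmonic : F.Monic) (hdeg : F.natDegree = 2)
    (hF : aeval θ F = 0) (P : ℤ[X]) :
    aeval θ P = ((P %ₘ F).coeff 0 : R) + ((P %ₘ F).coeff 1 : R) * θ := by
  have h1 : aeval θ P = aeval θ (P %ₘ F) := by
    conv_lhs => rw [← modByMonic_add_div P F]
    rw [map_add, map_mul, hF, zero_mul, add_zero]
  have h2 : (P %ₘ F).natDegree < 2 := by
    rw [← hdeg]
    exact natDegree_modByMonic_lt P hmonic (by rintro rfl; simp at hdeg)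
  rw [h1, aeval_eq_sum_range' h2]
  simp [Finset.sum_range_succ, Algebra.smul_def]

lemma dvd_of_aeval_eq_zero {F : ℤ[X]} (hmonic : F.Monic) (hdeg : F.natDegree = 2)
    (hF : aeval θ F = 0) (hlin : ∀ a b : ℤ, (a : R) + b * θ = 0 → a = 0 ∧ b = 0) {P : ℤ[X]}
    (hP : aeval θ P = 0) : F ∣ P := by
  rw [exists_aeval_eq_linear hmonic hdeg hF] at hP
  obtain ⟨h0, h1⟩ := hlin _ _ hP
  rw [← modByMonic_eq_zero_iff_dvd hmonic]
  have h2 : (P %ₘ F).natDegree < 2 := by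
    rw [← hdeg]
    exact natDegree_modByMonic_lt P hmonic (by rintro rfl; simp at hdeg)
  ext i
  rcases i with _ | _ | i
  · simpa using h0
  · simpa using h1
  · rw [coeff_eq_zero_of_natDegree_lt (by omega), coeff_zero]

lemma eq_zero_of_add_mul_eq_zero [CharZero R] [IsDomain R] {D : ℤ} (hD : ¬ IsSquare D)
    (hθ : θ ^ 2 = D) (a b : ℤ) (h : (a : R) + b * θ = 0) : a = 0 ∧ b = 0 := by
  have h1 : a ^ 2 = b ^ 2 * D := by
    have h2 : ((a ^ 2 : ℤ) : R) = ((b ^ 2 * D : ℤ) : R) := by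
      push_cast
      rw [← hθ]
      linear_combination (a - b * θ) * h
    exact_mod_cast h2
  have hb : b = 0 := by
    by_contra hb
    obtain ⟨c, rfl⟩ := (Int.pow_dvd_pow_iff two_ne_zero).mp (Dvd.intro _ h1.symm)
    apply hD
    refine ⟨c, ?_⟩
    have : b ^ 2 * D = b ^ 2 * (c * c) := by rw [← h1]; ring
    exact mul_left_cancel₀ (pow_ne_zero 2 hb) this
  subst hb
  simpa using h1

lemma natDegree_X_sq_add (b c : ℤ) : (X ^ 2 + (C b * X + C c) : ℤ[X]).natDegree = 2 ∧
    (X ^ 2 + (C b * X + C c) : ℤ[X]).Monic := by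
  have h : (C b * X + C c : ℤ[X]).degree < (2 : ℕ) :=
    lt_of_le_of_lt degree_linear_le (by norm_num)
  exact ⟨by compute_degree!, monic_X_pow_add (by simpa using h)⟩

lemma isGenerator_quadratic {b c : ℤ} (hF : θ ^ 2 + (b * θ + c) = 0)
    (hlin : ∀ a b : ℤ, (a : R) + b * θ = 0 → a = 0 ∧ b = 0)
    (hgen : ∀ r : R, ∃ (d : ℤ) (P : ℤ[X]), d ≠ 0 ∧ d • r = aeval θ P) :
    IsGenerator R θ (X ^ 2 + (C b * X + C c)) := by
  have h0 : aeval θ (X ^ 2 + (C b * X + C c) : ℤ[X]) = 0 := by simpa using hF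
  exact ⟨h0, fun P hP => dvd_of_aeval_eq_zero (natDegree_X_sq_add b c).2 (natDegree_X_sq_add b c).1
    h0 hlin hP, hgen⟩

/-- An order containing `θ = √D`, `D` odd, contains `(1 + θ) / 2` or lies in `ℤ[θ]` up to odd
index. -/
lemma exists_half_or_forall_odd [IsDomain R] [CharZero R] {D : ℤ} (hD : ¬ (2 : ℤ) ∣ D)
    (hθ : θ ^ 2 = D) (hhalf : ∀ r : R, 2 * r ≠ 1)
    (hgen : ∀ r : R, ∃ (d : ℤ) (P : ℤ[X]), d ≠ 0 ∧ d • r = aeval θ P) :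
    (∃ ω : R, 2 * ω = 1 + θ) ∨
      ∀ r : R, ∃ s a b : ℤ, ¬ (2 : ℤ) ∣ s ∧ (s : R) * r = a + b * θ := by
  by_cases hω : ∃ ω : R, 2 * ω = 1 + θ
  · exact Or.inl hω
  right
  -- When a and b are both odd, (1 + θ)/2 lies in R; when only a is odd, 1/2 does. When only b is
  -- odd, θ/2 lies in R, and its square D/4 with D odd again yields 1/2.
  have hsat : ∀ (r : R) (a b : ℤ), 2 * r = a + b * θ → ∃ a' b' : ℤ, r = a' + b' * θ := by
    intro r a b h
    rcases Int.even_or_odd' a with ⟨a', rfl | rfl⟩ <;> rcases Int.even_or_odd' b with ⟨b', rfl | rfl⟩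
    · refine ⟨a', b', ?_⟩
      have h2 : (2 : R) ≠ 0 := two_ne_zero
      apply mul_left_cancel₀ h2
      push_cast at h
      linear_combination h
    · exfalso
      push_cast at h
      have h1 : 2 * (r - a' - b' * θ) = θ := by linear_combination h
      obtain ⟨t, rfl | rfl⟩ := Int.even_or_odd' D
      · exact hD (dvd_mul_right _ _)
      · apply hhalf (2 * (r - a' - b' * θ) ^ 2 - t)
        push_cast at hθ
        have h3 : (2 * (r - a' - b' * θ)) ^ 2 = 2 * t + 1 := by rw [h1, hθ]
        linear_combination h3
    · exfalso
      push_cast at h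
      exact hhalf (r - a' - b' * θ) (by linear_combination h)
    · exfalso
      push_cast at h
      exact hω ⟨r - a' - b' * θ, by linear_combination h⟩
  intro r
  obtain ⟨d, P, hd, hP⟩ := hgen r
  have hF := natDegree_X_sq_add 0 (-D)
  rw [exists_aeval_eq_linear hF.2 hF.1 (by simp [hθ]), zsmul_eq_mul] at hP
  obtain ⟨v, s, rfl, hs⟩ := Int.exists_eq_prime_pow_mul Nat.prime_two hd
  refine ⟨s, ?_⟩
  have key : ∀ v : ℕ, ∀ a b : ℤ, (2 : R) ^ v * (s * r) = a + b * θ →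
      ∃ a b : ℤ, (s : R) * r = a + b * θ := by
    intro v
    induction v with
    | zero =>
      intro a b h
      exact ⟨a, b, by simpa using h⟩
    | succ v ih =>
      intro a b h
      obtain ⟨a', b', h'⟩ := hsat ((2 : R) ^ v * (s * r)) a b (by rw [← h]; ring)
      exact ih a' b' h'
  obtain ⟨a, b, hab⟩ := key v _ _ (by rw [← hP]; push_cast; ring)
  exact ⟨a, b, by simpa using hs, hab⟩

end Quadratic

/-! ### Multiplicativity of the index and the index of 2 -/

section Index

variable {Λ : Type*} [CommRing Λ]

lemma index_range_mulBy_of_isUnit {u : Λ} (hu : IsUnit u) : (mulBy Λ u).range.index = 1 := by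
  rw [AddSubgroup.index_eq_one, AddMonoidHom.range_eq_top]
  obtain ⟨w, hw⟩ := hu.exists_right_inv
  exact fun a => ⟨w * a, by rw [mulBy_apply, smul_eq_mul, ← mul_assoc, hw, one_mul]⟩

lemma IsAdicOrder.index_mul {l : ℕ} (hΛ : IsAdicOrder l Λ) {y z : Λ} {v : ℕ}
    (hy : y ∣ (l : Λ) ^ v) :
    (mulBy Λ (y * z)).range.index = (mulBy Λ z).range.index * (mulBy Λ y).range.index := by
  rw [mulBy_mul, AddMonoidHom.index_range_comp _ _
    (mulBy_injective_of_dvd (M := Λ) hΛ.regular hy)]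

lemma IsAdicOrder.index_pow {l : ℕ} (hΛ : IsAdicOrder l Λ) (v : ℕ) :
    (mulBy Λ ((l : Λ) ^ v)).range.index = (mulBy Λ (l : Λ)).range.index ^ v := by
  induction v with
  | zero => rw [pow_zero, pow_zero, index_range_mulBy_of_isUnit isUnit_one]
  | succ v ih =>
    rw [pow_succ, hΛ.index_mul (v := v) dvd_rfl, ih, mul_comm, ← pow_succ]

/-- The index of `2` in a quadratic order. -/
lemma IsAdicOrder.index_two (hΛ : IsAdicOrder 2 Λ) {τ : Λ} {D : ℤ} (hτ : τ ^ 2 = D)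
    (hD : D % 4 = 1)
    (hidx : ∀ (c : ℤ) (v : ℕ) (u : ℤ), c ^ 2 - D = 2 ^ v * u → ¬ (2 : ℤ) ∣ u →
      (mulBy Λ (τ - c)).range.index = 2 ^ v) {n : ℕ} {u : ℤ}
    (hn : 1 - D = 2 ^ n * u) (hu : ¬ (2 : ℤ) ∣ u) :
    (mulBy Λ ((2 : ℕ) : Λ)).range.index = 4 := by
  have hn0 : n ≠ 0 := by
    rintro rfl
    omega
  have hunit : IsUnit ((-u : ℤ) : Λ) := hΛ.isUnit_intCast (by simpa using hu)
  have hfac : (τ - (1 : ℤ)) * (τ - (-1 : ℤ)) = ((2 : ℕ) : Λ) ^ n * ((-u : ℤ) : Λ) := by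
    have h1 : (τ - (1 : ℤ)) * (τ - (-1 : ℤ)) = ((-(1 - D) : ℤ) : Λ) := by
      push_cast
      rw [← hτ]
      ring
    rw [h1, hn]
    push_cast
    ring
  have hdvd : τ - (1 : ℤ) ∣ ((2 : ℕ) : Λ) ^ n := by
    obtain ⟨w, hw⟩ := hunit.exists_right_inv
    exact ⟨(τ - (-1 : ℤ)) * w, by rw [← mul_assoc, hfac, mul_assoc, hw, mul_one]⟩
  -- Both τ - 1 and τ + 1 have index 2^n and their product is 2^n up to a unit, so the n-th power of
  -- the index of 2 is 4^n.
  have h1 := hΛ.index_mul (z := τ - (-1 : ℤ)) hdvd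
  rw [hfac, hΛ.index_mul (v := n) dvd_rfl, index_range_mulBy_of_isUnit hunit, one_mul,
    hΛ.index_pow, hidx 1 n u (by rw [← hn]; ring) hu, hidx (-1) n u (by rw [← hn]; ring) hu,
    ← mul_pow] at h1
  exact Nat.pow_left_injective hn0 h1

end Index

/-! ### Completions of modules commensurable with the order -/

section Commensurable

variable {l : ℕ} {R : Type*} [CommRing R] {N : Type*} [AddCommGroup N] [Module R N]

lemma AdicCompletion.map_eq_smul {I : Ideal R} {f : N →ₗ[R] N} {r : R} (hf : ∀ y, f y = r • y)
    (m : AdicCompletion I N) :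
    AdicCompletion.map I f m = algebraMap R (AdicCompletion I R) r • m := by
  rw [algebraMap_smul]
  apply AdicCompletion.ext
  intro n
  rw [AdicCompletion.map_val_apply, AdicCompletion.val_smul_apply]
  obtain ⟨y, hy⟩ := Submodule.Quotient.mk_surjective _ (m.val n)
  rw [← hy, ← Submodule.Quotient.mk_smul, ← hf]
  rfl

lemma IsLattice.self {Λ : Type*} [CommRing Λ] (hΛ : IsAdicOrder l Λ) : IsLattice l Λ Λ 1 where
  finite := inferInstance
  regular := hΛ.regular
  exists_map := ⟨LinearMap.proj 0, 0, fun a b hab => by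
      ext i
      rw [Subsingleton.elim i 0]
      exact hab, fun m => ⟨fun _ => m, by simp⟩⟩

/-- After completion the composites of ι and δ are l^v times a unit. Hence ι stays injective and its
image contains l^v times the completion of N. -/
lemma LAdic.isLattice (hΛ : IsAdicOrder l (LAdic l R R)) [hfin : Module.Finite R N]
    (hN : ∀ y : N, (l : R) • y = 0 → y = 0) (ι : R →ₗ[R] N) (δ : N →ₗ[R] R) {d : ℤ} (hd : d ≠ 0)
    (hιδ : ∀ y, ι (δ y) = (d : R) • y) (hδι : ∀ r, δ (ι r) = (d : R) • r) :
    IsLattice l (LAdic l R R) (LAdic l R N) 1 := by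
  obtain ⟨v, u, rfl, hu⟩ := Int.exists_eq_prime_pow_mul hΛ.prime hd
  have hunit := hΛ.isUnit_intCast hu
  obtain ⟨w, hw⟩ := hunit.exists_right_inv
  have hregN := LAdic.regular (l := l) hN
  let φ := AdicCompletion.map (Ideal.span {(l : R)}) ι
  let ψ := AdicCompletion.map (Ideal.span {(l : R)}) δ
  have h1 : ∀ m, φ (ψ m) = ((l : LAdic l R R) ^ v * (u : LAdic l R R)) • m := by
    intro m
    rw [AdicCompletion.map_comp_apply, AdicCompletion.map_eq_smul (f := ι ∘ₗ δ) hιδ]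
    congr 1
    rw [map_intCast]
    push_cast
    rfl
  have h2 : ∀ m, ψ (φ m) = ((l : LAdic l R R) ^ v * (u : LAdic l R R)) • m := by
    intro m
    rw [AdicCompletion.map_comp_apply, AdicCompletion.map_eq_smul (f := δ ∘ₗ ι) hδι]
    congr 1
    rw [map_intCast]
    push_cast
    rfl
  have hφ : Function.Injective φ := by
    rw [injective_iff_map_eq_zero]
    intro a ha
    have h3 := h2 a
    rw [ha, map_zero, mul_comm, mul_smul] at h3
    have h4 := congrArg (w • ·) h3.symm
    simp only [smul_zero, smul_smul] at h4
    rw [← mul_assoc, mul_comm w, hw, one_mul] at h4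
    apply IsAdicOrder.mulBy_injective_pow (Λ := LAdic l R R) (M := LAdic l R R) hΛ.regular v
    rw [map_zero]
    exact h4
  have hrange : ∀ m, φ (w • ψ m) = (l : LAdic l R R) ^ v • m := by
    intro m
    rw [map_smul, h1, smul_smul]
    congr 1
    rw [mul_left_comm, mul_comm w, hw, mul_one]
  refine ⟨?_, hregN, φ ∘ₗ LinearMap.proj 0, v, ?_, ?_⟩
  · obtain ⟨s, hs⟩ := hfin.fg_top
    refine ⟨⟨(s.finite_toSet.image (AdicCompletion.of (Ideal.span {(l : R)}) N)).toFinset, ?_⟩⟩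
    rw [Set.Finite.coe_toFinset, eq_top_iff]
    set S := Submodule.span (LAdic l R R) (AdicCompletion.of (Ideal.span {(l : R)}) N '' s)
    have hof : ∀ y : N, AdicCompletion.of (Ideal.span {(l : R)}) N y ∈ S := by
      intro y
      have hle : (⊤ : Submodule R N) ≤
          (S.restrictScalars R).comap (AdicCompletion.of (Ideal.span {(l : R)}) N) := by
        rw [← hs, Submodule.span_le]
        intro y hy
        exact Submodule.subset_span ⟨y, hy, rfl⟩
      exact hle (Submodule.mem_top (x := y))
    intro m _
    -- Up to l^v times the completion, m comes from N; the remaining term lies in the image of φ,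
    -- which is generated by ι 1.
    obtain ⟨y, m', rfl⟩ := LAdic.exists_eq_add m v
    refine S.add_mem (hof y) ?_
    rw [← hrange, map_smul]
    refine S.smul_mem _ ?_
    have h5 : ∀ a, φ a = a • AdicCompletion.of (Ideal.span {(l : R)}) N (ι 1) := by
      intro a
      rw [← AdicCompletion.map_of, ← map_smul]
      congr 1
      exact (mul_one a).symm
    rw [h5]
    exact S.smul_mem _ (hof _)
  · exact hφ.comp (fun a b hab => by
      funext i
      rw [Subsingleton.elim i 0]
      exact hab)
  · intro m
    exact ⟨fun _ => w • ψ m, hrange m⟩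

end Commensurable

/-! ### The completed ring of integers as a lattice of rank one -/

section Integers

variable {L : Type*} [Field L] [Algebra ℚ L] {R : Subalgebra ℤ L}

lemma IsOrder.exists_smul_mem (hR : IsOrder R) (z : L) : ∃ d : ℤ, d ≠ 0 ∧ d • z ∈ R := by
  have hz : z ∈ Submodule.span ℚ (R : Set L) := hR.span_eq_top ▸ Submodule.mem_top
  induction hz using Submodule.span_induction with
  | mem z hz => exact ⟨1, one_ne_zero, by simpa using hz⟩
  | zero => exact ⟨1, one_ne_zero, by simp⟩
  | add y z _ _ hy hz =>
    obtain ⟨a, ha, hay⟩ := hy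
    obtain ⟨b, hb, hbz⟩ := hz
    refine ⟨a * b, mul_ne_zero ha hb, ?_⟩
    have : (a * b) • (y + z) = b • (a • y) + a • (b • z) := by module
    rw [this]
    exact R.add_mem (R.smul_mem hay b) (R.smul_mem hbz a)
  | smul t z _ hz =>
    obtain ⟨a, ha, haz⟩ := hz
    refine ⟨a * t.den, mul_ne_zero ha (by exact_mod_cast t.den_ne_zero), ?_⟩
    have : (a * (t.den : ℤ)) • (t • z) = t.num • (a • z) := by
      simp only [Algebra.smul_def]
      have h : (t.den : L) * algebraMap ℚ L t = t.num := by
        rw [← map_natCast (algebraMap ℚ L), ← map_mul, mul_comm, Rat.mul_den_eq_num, map_intCast]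
      push_cast
      linear_combination (a : L) * z * h
    rw [this]
    exact R.smul_mem haz _

lemma IsOrder.exists_forall_smul_mem (hR : IsOrder R) {s : Set L} (hs : s.Finite) :
    ∃ d : ℤ, d ≠ 0 ∧ ∀ z ∈ s, d • z ∈ R := by
  induction s, hs using Set.Finite.induction_on with
  | empty => exact ⟨1, one_ne_zero, by simp⟩
  | @insert z s _ _ ih =>
    obtain ⟨a, ha, haz⟩ := hR.exists_smul_mem z
    obtain ⟨b, hb, hbs⟩ := ih
    refine ⟨a * b, mul_ne_zero ha hb, ?_⟩
    intro y hy
    rcases Set.mem_insert_iff.mp hy with rfl | hy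
    · rw [mul_comm, mul_smul]
      exact R.smul_mem haz b
    · rw [mul_smul]
      exact R.smul_mem (hbs y hy) a

/-- The integral closure of ℤ in a number field is finite over ℤ, and a common denominator of its
generators moves it into R. -/
lemma integersOver.exists_finite [CharZero L] [FiniteDimensional ℚ L] (hR : IsOrder R) :
    Module.Finite R (integersOver R hR) ∧
      ∃ d : ℤ, d ≠ 0 ∧ ∀ y : integersOver R hR, d • (y : L) ∈ R := by
  have hC : IsNoetherian ℤ (integralClosure ℤ L) :=
    IsIntegralClosure.isNoetherian ℤ ℚ L (integralClosure ℤ L)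
  have hC' : Module.Finite ℤ (integralClosure ℤ L) := inferInstance
  let E : integralClosure ℤ L ≃+ integersOver R hR :=
    { toFun := fun z => ⟨z.1, z.2⟩
      invFun := fun z => ⟨z.1, z.2⟩
      left_inv := fun _ => rfl
      right_inv := fun _ => rfl
      map_add' := fun _ _ => rfl }
  have hfin : Module.Finite ℤ (integersOver R hR) := Module.Finite.equiv E.toIntLinearEquiv
  refine ⟨Module.Finite.of_restrictScalars_finite ℤ R _, ?_⟩
  obtain ⟨s, hs⟩ := hC'.fg_top
  obtain ⟨d, hd, hds⟩ := hR.exists_forall_smul_mem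
    (s.finite_toSet.image (Subtype.val : integralClosure ℤ L → L))
  refine ⟨d, hd, fun y => ?_⟩
  let T : Submodule ℤ (integralClosure ℤ L) :=
    (Subalgebra.toSubmodule R).comap (d • (integralClosure ℤ L).val.toLinearMap)
  have hT : (⊤ : Submodule ℤ (integralClosure ℤ L)) ≤ T := by
    rw [← hs, Submodule.span_le]
    intro z hz
    exact hds _ ⟨z, hz, rfl⟩
  exact hT (Submodule.mem_top (x := E.symm y))

variable {l : ℕ}

lemma integersOver.isLattice [CharZero L] [FiniteDimensional ℚ L] (hR : IsOrder R)
    (hΛ : IsAdicOrder l (LAdic l R R)) :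
    IsLattice l (LAdic l R R) (LAdic l R (integersOver R hR)) 1 := by
  obtain ⟨hfin, d, hd, hdR⟩ := integersOver.exists_finite hR
  have := hR.finite
  let ι : R →ₗ[R] integersOver R hR :=
    { toFun := fun r => ⟨r.1, (IsIntegral.of_finite ℤ r).map R.val⟩
      map_add' := fun _ _ => rfl
      map_smul' := fun _ _ => rfl }
  let δ : integersOver R hR →ₗ[R] R :=
    { toFun := fun y => ⟨d • (y : L), hdR y⟩
      map_add' := fun y z => Subtype.ext (smul_add d (y : L) (z : L))
      map_smul' := fun r y => Subtype.ext (smul_comm d r (y : L)) }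
  refine LAdic.isLattice hΛ (fun y hy => ?_) ι δ hd (fun y => ?_) fun r => ?_
  · have h1 := congrArg (Subtype.val : integersOver R hR → L) hy
    have h2 : (l : L) * (y : L) = 0 := by
      simpa [Algebra.smul_def, Subalgebra.smul_def] using h1
    apply Subtype.ext
    exact (mul_eq_zero.mp h2).resolve_left (by exact_mod_cast hΛ.prime.ne_zero)
  · apply Subtype.ext
    change d • (y : L) = ((d : R) : L) * (y : L)
    simp [zsmul_eq_mul]
  · apply Subtype.ext
    change d • (r : L) = ((d : R) : L) * (r : L)
    simp [zsmul_eq_mul]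

/-- If `r / l` is integral, then multiplication by `r` on the completed ring of integers is
divisible by `l`. -/
lemma integersOver.exists_smul_eq (hR : IsOrder R) {r : R} {z : L} (hz : IsIntegral ℤ z)
    (hr : (r : L) = l * z)
    (m : LAdic l R (integersOver R hR)) :
    ∃ m' : LAdic l R (integersOver R hR),
      algebraMap R (LAdic l R R) r • m = (l : LAdic l R R) • m' := by
  let μ : integersOver R hR →ₗ[R] integersOver R hR :=
    { toFun := fun y => ⟨z * y, hz.mul y.2⟩
      map_add' := fun y y' => Subtype.ext (mul_add z (y : L) (y' : L))
      map_smul' := fun r y => Subtype.ext (mul_smul_comm r z (y : L)) }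
  refine ⟨AdicCompletion.map _ μ m, ?_⟩
  rw [← map_natCast (algebraMap R (LAdic l R R)),
    ← AdicCompletion.map_eq_smul (f := LinearMap.lsmul R (integersOver R hR) (l : R))
      (fun _ => rfl), AdicCompletion.map_comp_apply]
  refine (AdicCompletion.map_eq_smul (fun y => ?_) m).symm
  apply Subtype.ext
  change ((l : R) : L) * (z * (y : L)) = (r : L) * (y : L)
  rw [hr]
  push_cast
  ring

end Integers

/-! ### The exceptional case -/

section Exceptional

open Polynomial

/-- A maximal ideal above 2 has index 2 or 4, and index 2 is impossible because X^2 - X + 1 has no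
root in the field with two elements. -/
lemma IsAdicOrder.isMaximal_span_two {Λ : Type*} [CommRing Λ]
    (htwo : (mulBy Λ ((2 : ℕ) : Λ)).range.index = 4) {ω : Λ} {ε : ℤ} (hε : ¬ (2 : ℤ) ∣ ε)
    (hω : ω ^ 2 - ω + ε = 0) : (Ideal.span {((2 : ℕ) : Λ)}).IsMaximal := by
  rw [← index_span_singleton] at htwo
  refine Ideal.isMaximal_of_index_eq (by rw [htwo]; norm_num) (by rw [htwo]; norm_num)
    fun P hP hle => ?_
  have hdvd := AddSubgroup.index_dvd_of_le (show (Ideal.span {((2 : ℕ) : Λ)}).toAddSubgroup ≤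
    P.toAddSubgroup from hle)
  rw [htwo] at hdvd ⊢
  have h4 : P.toAddSubgroup.index ≤ 4 := Nat.le_of_dvd (by norm_num) hdvd
  have hcard : Nat.card (Λ ⧸ P) = P.toAddSubgroup.index := rfl
  have hnt : Nontrivial (Λ ⧸ P) := Ideal.Quotient.nontrivial_iff.mpr hP.ne_top
  have h2P : (2 : Λ) ∈ P := hle (by simp)
  have hne2 : P.toAddSubgroup.index ≠ 2 := by
    intro h2
    rw [h2, Nat.card_eq_two_iff' (0 : Λ ⧸ P)] at hcard
    obtain ⟨y, -, hy⟩ := hcard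
    have hεP : Ideal.Quotient.mk P (ε : Λ) = 1 := by
      obtain ⟨t, ht⟩ : Odd ε := Int.not_even_iff_odd.mp (by rwa [even_iff_two_dvd])
      have h0 : Ideal.Quotient.mk P (2 : Λ) = 0 := Ideal.Quotient.eq_zero_iff_mem.mpr h2P
      rw [ht]
      push_cast
      rw [map_add, map_mul, h0, zero_mul, zero_add, map_one]
    have hω' := congrArg (Ideal.Quotient.mk P) hω
    rw [map_add, map_sub, map_pow, hεP, map_zero] at hω'
    by_cases h0 : Ideal.Quotient.mk P ω = 0
    · rw [h0] at hω'
      simp at hω'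
    · rw [hy _ h0, ← hy 1 one_ne_zero] at hω'
      simp at hω'
  have hne1 : P.toAddSubgroup.index ≠ 1 := by
    rw [← hcard]
    intro h1
    exact not_subsingleton _ (Nat.card_eq_one_iff_unique.mp h1).1
  interval_cases h : P.toAddSubgroup.index <;> simp_all

/-- If `R` lies in `ℤ[θ]` up to odd index, its completion is generated over `ℤ` by `1` modulo
`θ - 1`. -/
lemma LAdic.exists_eq_intCast_add {R : Type*} [CommRing R] {θ : R} {v : ℕ}
    (hv : algebraMap R (LAdic 2 R R) (θ - 1) ∣ ((2 : ℕ) : LAdic 2 R R) ^ v)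
    (hodd : ∀ r : R, ∃ s a b : ℤ, ¬ (2 : ℤ) ∣ s ∧ (s : R) * r = a + b * θ) (a : LAdic 2 R R) :
    ∃ (z : ℤ) (a' : LAdic 2 R R), a = z + algebraMap R (LAdic 2 R R) (θ - 1) * a' := by
  obtain ⟨r, m, hm⟩ := LAdic.exists_eq_algebraMap_add a v
  obtain ⟨s, i, j, hs, hr⟩ := hodd r
  obtain ⟨y, hy⟩ := hv
  have hcop : IsCoprime s ((2 : ℤ) ^ v) := by
    apply IsCoprime.pow_right
    rw [isCoprime_comm]
    exact (Prime.coprime_iff_not_dvd Int.prime_two).mpr hs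
  obtain ⟨t, t', ht⟩ := hcop
  have ht' := congrArg (Int.cast : ℤ → LAdic 2 R R) ht
  have hr' := congrArg (algebraMap R (LAdic 2 R R)) hr
  rw [map_mul, map_add, map_mul, map_intCast, map_intCast, map_intCast] at hr'
  set ρ := algebraMap R (LAdic 2 R R) r
  set x := algebraMap R (LAdic 2 R R) (θ - 1) with hx
  have hθ : algebraMap R (LAdic 2 R R) θ = x + 1 := by rw [hx, map_sub, map_one]; ring
  rw [hθ] at hr'
  push_cast at ht' hy
  -- From t s + t' 2^v = 1 and s r = i + j θ one gets r = t (i + j θ) + t' 2^v r; now substitute θ =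
  -- 1 + x and 2^v = x y.
  refine ⟨t * (i + j), y * m + t * j + y * t' * ρ, ?_⟩
  push_cast at hm ⊢
  rw [hm]
  linear_combination (-ρ) * ht' + t * hr' + (m + t' * ρ) * hy

variable {R : Type*} [CommRing R] [IsDomain R] [CharZero R] [Module.Finite ℤ R] {θ : R}
  {M : Type*} [AddCommGroup M] [Module (LAdic 2 R R) M] {e : ℕ}

/-- If the order contains `(1 + √D) / 2`, the reduction of a lattice is generated by `e`
elements. -/
lemma IsLattice.spannedMod_of_half (hΛ : IsAdicOrder 2 (LAdic 2 R R))
    (hM : IsLattice 2 (LAdic 2 R R) M e) {D : ℤ} (hD : D % 4 = 1) (hD1 : D ≠ 1) (hθ : θ ^ 2 = D)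
    (hlin : ∀ a b : ℤ, (a : R) + b * θ = 0 → a = 0 ∧ b = 0)
    (hgen : ∀ r : R, ∃ (d : ℤ) (P : ℤ[X]), d ≠ 0 ∧ d • r = aeval θ P)
    (htwo : (mulBy (LAdic 2 R R) ((2 : ℕ) : LAdic 2 R R)).range.index = 4)
    {ω : R} (hω : 2 * ω = 1 + θ) :
    SpannedMod e (algebraMap R (LAdic 2 R R) (θ - 1)) M := by
  obtain ⟨ε, hε⟩ : ∃ ε : ℤ, 1 - D = 4 * ε := ⟨(1 - D) / 4, by omega⟩
  have hωε : ω ^ 2 + (((-1 : ℤ) : R) * ω + (ε : R)) = 0 := by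
    have h4 : (4 : R) ≠ 0 := by norm_num
    apply mul_left_cancel₀ h4
    have h5 : ((1 - D : ℤ) : R) = ((4 * ε : ℤ) : R) := by rw [hε]
    push_cast at h5 ⊢
    have h6 : θ = 2 * ω - 1 := by rw [hω]; ring
    rw [h6] at hθ
    linear_combination hθ - h5
  have hωgen : IsGenerator R ω (X ^ 2 + (C (-1) * X + C ε)) := by
    refine isGenerator_quadratic hωε (fun a b h => ?_) (fun r => ?_)
    · have h1 : ((2 * a + b : ℤ) : R) + (b : R) * θ = 0 := by
        push_cast
        linear_combination 2 * h - b * hω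
      obtain ⟨h2, h3⟩ := hlin _ _ h1
      omega
    · obtain ⟨d, P, hd, hP⟩ := hgen r
      refine ⟨d, P.comp (X + X - 1), hd, ?_⟩
      rw [hP, aeval_comp]
      have h : ω + ω - 1 = θ := by linear_combination hω
      simp [h]
  have heval : ∀ c : ℤ, (X ^ 2 + (C (-1) * X + C ε) : ℤ[X]).eval c = c ^ 2 - c + ε := by
    intro c
    simp
    ring
  have hx2 : ∃ v : ℕ, algebraMap R (LAdic 2 R R) (θ - 1) ∣ ((2 : ℕ) : LAdic 2 R R) ^ v := by
    have hF := natDegree_X_sq_add 0 (-D)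
    have h0 : aeval θ (X ^ 2 + (C 0 * X + C (-D)) : ℤ[X]) = 0 := by simp [hθ]
    have hne : (X ^ 2 + (C 0 * X + C (-D)) : ℤ[X]).eval 1 ≠ 0 := by
      simp
      omega
    obtain ⟨v, u, hv, hu⟩ := Int.exists_eq_prime_pow_mul Nat.prime_two hne
    have := LAdic.sub_dvd_pow hΛ h0 hv hu
    rw [Int.cast_one] at this
    exact ⟨v, this⟩
  obtain ⟨v, hv⟩ := hx2
  -- It is enough to treat some y divisible by 2, since x divides 2^v and hence y^v.
  suffices h : ∃ y : LAdic 2 R R, ((2 : ℕ) : LAdic 2 R R) ∣ y ∧ SpannedMod e y M by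
    obtain ⟨y, hy, hs⟩ := h
    exact (hs.pow v).of_dvd (hv.trans (pow_dvd_pow_of_dvd hy v))
  by_cases hpar : (2 : ℤ) ∣ ε
  -- Split case. X^2 - X + ε takes only even values, and passing from c to c + 2 changes the value
  -- by 4c + 2, so each parity class contains a c' whose value is exactly divisible by 2.
  · have hex : ∀ c : ℤ, ∃ c' : ℤ, (2 : ℤ) ∣ c' - c ∧
        ((2 : ℕ) : ℤ) ∣ (X ^ 2 + (C (-1) * X + C ε) : ℤ[X]).eval c' ∧
        ¬ ((2 : ℕ) : ℤ) ^ 2 ∣ (X ^ 2 + (C (-1) * X + C ε) : ℤ[X]).eval c' := by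
      intro c
      have h2 : ∀ c : ℤ, (2 : ℤ) ∣ c ^ 2 - c + ε := by
        intro c
        refine dvd_add ?_ hpar
        have := Int.even_mul_pred_self c
        rw [even_iff_two_dvd] at this
        have h3 : c ^ 2 - c = c * (c - 1) := by ring
        rwa [h3]
      by_cases h4 : (4 : ℤ) ∣ c ^ 2 - c + ε
      · refine ⟨c + 2, by simp, ?_, ?_⟩
        · rw [heval]
          exact_mod_cast h2 (c + 2)
        · rw [heval]
          have h5 : (c + 2) ^ 2 - (c + 2) + ε = (c ^ 2 - c + ε) + 4 * c + 2 := by ring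
          rw [h5]
          push_cast
          omega
      · refine ⟨c, by simp, ?_, ?_⟩
        · rw [heval]
          exact_mod_cast h2 c
        · rw [heval]
          push_cast
          omega
    obtain ⟨c₀, hc₀, h₀, h₀'⟩ := hex 0
    obtain ⟨c₁, hc₁, h₁, h₁'⟩ := hex 1
    have s₀ := hM.spannedMod_sub hΛ hωgen h₀ h₀'
    have s₁ := hM.spannedMod_sub hΛ hωgen h₁ h₁'
    have hodd : ¬ ((2 : ℕ) : ℤ) ∣ c₁ - c₀ := by
      push_cast
      omega
    obtain ⟨w, hw⟩ := (hΛ.isUnit_intCast hodd).exists_right_inv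
    -- The elements ω - c₀ and ω - c₁ differ by an odd integer, a unit, so they are comaximal. With
    -- c₀ even and c₁ odd their product is ω^2 - ω + ε = 0 modulo 2.
    refine ⟨_, ?_, s₀.mul s₁ (a := w) (b := -w) ?_⟩
    · obtain ⟨t, ht⟩ : ∃ t : R, (ω - c₀) * (ω - c₁) = 2 * t := by
        obtain ⟨a, ha⟩ : (2 : ℤ) ∣ 1 - c₀ - c₁ := by omega
        obtain ⟨b, hb⟩ : (2 : ℤ) ∣ c₀ * c₁ - ε :=
          dvd_sub (Dvd.dvd.mul_right (by simpa using hc₀) _) hpar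
        have ha' : (1 - c₀ - c₁ : R) = 2 * a := by exact_mod_cast congrArg (Int.cast : ℤ → R) ha
        have hb' : (c₀ * c₁ - ε : R) = 2 * b := by exact_mod_cast congrArg (Int.cast : ℤ → R) hb
        refine ⟨a * ω + b, ?_⟩
        push_cast at hωε
        linear_combination hωε + ω * ha' + hb'
      refine ⟨algebraMap R (LAdic 2 R R) t, ?_⟩
      rw [← map_mul, ht, map_mul, map_ofNat]
      push_cast
      rfl
    · simp only [map_sub, map_intCast]
      push_cast at hw
      linear_combination hw
  -- Inert case: 2 itself generates a maximal ideal.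
  · refine ⟨((2 : ℕ) : LAdic 2 R R), dvd_rfl, ?_⟩
    refine hM.spannedMod_of_isMaximal hΛ (v := 1) (by rw [pow_one])
      (IsAdicOrder.isMaximal_span_two htwo hpar (ω := algebraMap R (LAdic 2 R R) ω) ?_)
    have := congrArg (algebraMap R (LAdic 2 R R)) hωε
    rw [map_add, map_add, map_mul, map_pow, map_intCast, map_intCast, map_zero] at this
    push_cast at this
    linear_combination this

end Exceptional

/-! ### The exceptional case when the order lacks (1 + √D)/2 -/

section Exceptional

lemma nsmulIndex_one (G : Type*) [AddCommGroup G] : nsmulIndex 1 G = 1 := by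
  rw [nsmulIndex, AddSubgroup.index_eq_one, AddMonoidHom.range_eq_top]
  exact fun a => ⟨a, by simp⟩

variable {Λ : Type*} [CommRing Λ]

/-- If `Λ` is generated over `ℤ` by `1` modulo `x`, additive isomorphisms between modules killed
by `x` are linear. -/
lemma nonempty_linearEquiv_of_addEquiv {x : Λ}
    (hint : ∀ a : Λ, ∃ (z : ℤ) (a' : Λ), a = z + x * a') {A B : Type*} [AddCommGroup A]
    [AddCommGroup B] [Module Λ A] [Module Λ B] (hA : ∀ a : A, x • a = 0) (hB : ∀ b : B, x • b = 0)
    (f : A ≃+ B) : Nonempty (A ≃ₗ[Λ] B) := by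
  refine ⟨f.toLinearEquiv fun c a => ?_⟩
  obtain ⟨z, c', rfl⟩ := hint c
  rw [add_smul, add_smul, mul_comm, mul_smul, mul_smul, hA, hB, smul_zero, smul_zero, add_zero,
    add_zero, Int.cast_smul_eq_zsmul, Int.cast_smul_eq_zsmul, map_zsmul]

lemma smul_modBy_eq_zero {M : Type*} [AddCommGroup M] [Module Λ M] (x : Λ) (g : ModBy x M) :
    x • g = 0 := by
  obtain ⟨m, rfl⟩ := Submodule.Quotient.mk_surjective _ g
  rw [← Submodule.Quotient.mk_smul, Submodule.Quotient.mk_eq_zero]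
  exact ⟨m, rfl⟩

/-- Lattices over `Λ = ℤ₂[√D]`, `D ≡ 1 mod 4`: the reduction is a sum of reductions of `Λ` and
of the overorder `O`. -/
lemma IsLattice.exists_modBy_equiv (hΛ : IsAdicOrder 2 Λ) {M : Type*} [AddCommGroup M]
    [Module Λ M] {e : ℕ} (hM : IsLattice 2 Λ M e) {O : Type*} [AddCommGroup O] [Module Λ O]
    (hO : IsLattice 2 Λ O 1) {τ : Λ} {D : ℤ} (hτ : τ ^ 2 = D) (hD : D % 4 = 1)
    (hidx : ∀ (c : ℤ) (v : ℕ) (u : ℤ), c ^ 2 - D = 2 ^ v * u → ¬ (2 : ℤ) ∣ u →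
      (mulBy Λ (τ - c)).range.index = 2 ^ v)
    (htwo : (mulBy Λ ((2 : ℕ) : Λ)).range.index = 4) {n : ℕ} {u : ℤ}
    (hn : 1 - D = 2 ^ n * u) (hu : ¬ (2 : ℤ) ∣ u)
    (hint : ∀ a : Λ, ∃ (z : ℤ) (a' : Λ), a = z + (τ - 1) * a')
    (hOx : ∀ m : O, ∃ m' : O, (τ - 1) • m = ((2 : ℕ) : Λ) • m') :
    ∃ a b : ℕ, a + b = e ∧ Nonempty (ModBy (τ - 1) M ≃ₗ[Λ]
      ((Fin a → Λ ⧸ Ideal.span {τ - 1}) × (Fin b → ModBy (τ - 1) O))) := by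
  obtain ⟨hn2, hfinM, hkillM, hcardM, f, hef, hfe, hf⟩ :=
    hM.exists_nsmulIndex_modBy hΛ hτ hD hidx htwo hn hu
  obtain ⟨-, hfinΛ, hkillΛ, hcardΛ, g, hg1, hg2, hg⟩ :=
    (IsLattice.self hΛ).exists_nsmulIndex_modBy hΛ hτ hD hidx htwo hn hu
  obtain ⟨-, hfinO, hkillO, hcardO, h, hh1, hh2, hh⟩ :=
    hO.exists_nsmulIndex_modBy hΛ hτ hD hidx htwo hn hu
  have hinj := Nat.pow_right_injective (le_refl 2)
  -- Λ/(τ - 1, 2) is a quotient of ℤ/2, so its order 2^g is at most 2.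
  have hgone : g = 1 := by
    have h1 := hg 1 le_rfl (by omega)
    rw [nsmulIndex_modBy] at h1
    set S := (mulBy Λ (τ - 1)).range ⊔ (mulBy Λ ((2 ^ 1 : ℕ) : Λ)).range with hS
    have hxS : ∀ a, (τ - 1) * a ∈ S := fun a =>
      (le_sup_left : (mulBy Λ (τ - 1)).range ≤ S) ⟨a, rfl⟩
    have h2S : ∀ a, 2 * a ∈ S := fun a =>
      (le_sup_right : (mulBy Λ ((2 ^ 1 : ℕ) : Λ)).range ≤ S) ⟨a, by simp⟩
    let q : ℤ →+ Λ ⧸ S := (QuotientAddGroup.mk' S).comp (Int.castAddHom Λ)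
    have hq : Function.Surjective q := by
      intro a
      obtain ⟨a, rfl⟩ := QuotientAddGroup.mk'_surjective _ a
      obtain ⟨z, a', ha⟩ := hint a
      refine ⟨z, (QuotientAddGroup.eq (s := S)).mpr ?_⟩
      rw [ha]
      simpa using hxS a'
    have hle : AddSubgroup.zmultiples (2 : ℤ) ≤ q.ker := by
      rw [AddSubgroup.zmultiples_le]
      refine (QuotientAddGroup.eq_zero_iff (N := S) _).mpr ?_
      simpa using h2S 1
    have h3 := AddSubgroup.index_dvd_of_le hle
    have h4 : q.ker.index = S.index :=
      Nat.card_congr (QuotientAddGroup.quotientKerEquivOfSurjective _ hq).toEquiv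
    rw [h4, h1, Int.index_zmultiples] at h3
    have h5 : 2 ^ (g + (1 - 1) * 1) ≤ 2 ^ 1 := Nat.le_of_dvd (by norm_num) h3
    rw [Nat.pow_le_pow_iff_right (by norm_num)] at h5
    omega
  -- Since (τ - 1)O lies in 2O, the relevant quotient is O/2O, of order 4.
  have hhtwo : h = 2 := by
    have h1 := hh 1 le_rfl (by omega)
    rw [nsmulIndex_modBy] at h1
    have hle : (mulBy O (τ - 1)).range ≤ (mulBy O ((2 ^ 1 : ℕ) : Λ)).range := by
      rintro _ ⟨m, rfl⟩
      obtain ⟨m', hm'⟩ := hOx m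
      exact ⟨m', by rw [mulBy_apply, mulBy_apply, hm', pow_one]⟩
    rw [sup_eq_right.mpr hle, pow_one, hO.index_eq hΛ (v := 1) (by rw [pow_one]), htwo] at h1
    have h2 : (2 : ℕ) ^ 2 = 2 ^ h := by simpa using h1
    exact (hinj h2).symm
  subst hgone hhtwo
  have hEΛ : ModBy (τ - 1) Λ ≃+ Λ ⧸ Ideal.span {τ - 1} :=
    (Submodule.quotEquivOfEq _ _ (range_lsmul_self (τ - 1))).toAddEquiv
  have : Finite (Λ ⧸ Ideal.span {τ - 1}) := Finite.of_equiv _ hEΛ.toEquiv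
  -- The parameters are additive, so a and b solve a + b = e and a + 2b = f.
  refine ⟨2 * e - f, f - e, by omega, ?_⟩
  have hkillΛ' : ∀ a : Λ ⧸ Ideal.span {τ - 1}, 2 ^ n • a = 0 := by
    intro a
    apply hEΛ.symm.injective
    rw [map_nsmul, hkillΛ, map_zero]
  have hxΛ : ∀ a : Λ ⧸ Ideal.span {τ - 1}, (τ - 1) • a = 0 := by
    intro a
    obtain ⟨a, rfl⟩ := Ideal.Quotient.mk_surjective a
    refine Ideal.Quotient.eq_zero_iff_mem.mpr ?_
    exact Ideal.mul_mem_right _ _ (Ideal.mem_span_singleton_self _)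
  suffices hF : Nonempty (ModBy (τ - 1) M ≃+
      ((Fin (2 * e - f) → Λ ⧸ Ideal.span {τ - 1}) × (Fin (f - e) → ModBy (τ - 1) O))) by
    obtain ⟨F⟩ := hF
    exact nonempty_linearEquiv_of_addEquiv hint (smul_modBy_eq_zero _)
      (fun w => Prod.ext (funext fun i => hxΛ (w.1 i))
        (funext fun i => smul_modBy_eq_zero _ (w.2 i))) F
  refine nonempty_addEquiv_of_nsmulIndex_eq Nat.prime_two (n := n) hkillM
    (fun w => Prod.ext (funext fun i => hkillΛ' (w.1 i)) (funext fun i => hkillO (w.2 i)))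
    fun i hi => ?_
  rw [nsmulIndex_prod, nsmulIndex_pi, nsmulIndex_pi]
  simp only [Finset.prod_const, Finset.card_univ, Fintype.card_fin]
  rw [← nsmulIndex_congr hEΛ]
  rcases Nat.eq_zero_or_pos i with rfl | hi0
  · simp [nsmulIndex_one]
  rcases Nat.lt_or_ge i n with hin | hin
  · rw [hf i hi0 hin, hg i hi0 hin, hh i hi0 hin, ← pow_mul, ← pow_mul, ← pow_add]
    congr 1
    zify [hef, hfe, show 1 ≤ i from hi0]
    ring
  · obtain rfl : i = n := le_antisymm hi hin
    rw [hcardM, hcardΛ, hcardO, ← pow_mul, ← pow_mul, ← pow_add]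
    congr 1
    zify [hef, hfe]
    ring

end Exceptional

/-! ### From number fields and complex embeddings to the completed order -/

section Main

open Polynomial

lemma exists_mul_aeval_eq_eval₂ {K : Type*} [Field K] [Algebra ℚ K] (g : K) (f : ℚ[X]) :
    ∃ (d : ℤ) (P : ℤ[X]), d ≠ 0 ∧
      (d : K) * f.eval₂ (algebraMap ℚ K) g = P.eval₂ (Int.castRingHom K) g := by
  obtain ⟨d, hd, hP⟩ := IsLocalization.integerNormalization_spec (nonZeroDivisors ℤ) f
  refine ⟨d, IsLocalization.integerNormalization (nonZeroDivisors ℤ) f,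
    nonZeroDivisors.ne_zero hd, ?_⟩
  have h1 := congrArg (eval₂ (algebraMap ℚ K) g) hP
  have h2 : eval₂ (algebraMap ℚ K) g (d : ℚ[X]) = d := map_intCast (eval₂RingHom _ g) d
  rw [zsmul_eq_mul, eval₂_mul, eval₂_map, h2] at h1
  rw [← h1]
  congr 1
  exact RingHom.ext_int _ _

lemma exists_mul_eq_eval₂_gen {α : ℂ} (hα : IsIntegral ℚ α) (z : ℚ⟮α⟯) :
    ∃ (d : ℤ) (P : ℤ[X]), d ≠ 0 ∧
      (d : ℚ⟮α⟯) * z =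
        P.eval₂ (Int.castRingHom ℚ⟮α⟯) (IntermediateField.AdjoinSimple.gen ℚ α) := by
  obtain ⟨f, hf⟩ := (IntermediateField.adjoin.powerBasis hα).exists_eq_aeval' z
  rw [IntermediateField.adjoin.powerBasis_gen] at hf
  rw [hf]
  exact exists_mul_aeval_eq_eval₂ _ f

lemma IsOrder.isAdicOrder {L : Type*} [Field L] [Algebra ℚ L] [CharZero L] {R : Subalgebra ℤ L}
    (hR : IsOrder R) {l : ℕ} (hl : l.Prime) : IsAdicOrder l (LAdic l R R) := by
  have := hR.finite
  have hl0 : (l : R) ≠ 0 := by exact_mod_cast hl.ne_zero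
  refine LAdic.isAdicOrder hl (fun y hy => (mul_eq_zero.mp hy).resolve_left hl0) ?_
  apply Nat.finite_of_card_ne_zero
  rw [card_quotient_span]
  have h := index_range_mulBy_int_ne_zero (A := R) (d := (l : ℤ)) (by exact_mod_cast hl.ne_zero)
  have heq : mulBy R (l : ℤ) = mulBy R (l : R) := by
    ext m
    simp
  rwa [heq] at h

/-- Here p is odd and q is an odd power of p, so q ≡ p mod 4, and the Jacobi symbol is the sign that
makes D = ±q congruent to 1 mod 4. -/
lemma IsExceptional.properties {p k q l : ℕ} (hp : p.Prime) (hq : q = p ^ k) (hlp : l ≠ p)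
    {α : ℂ} (h : IsExceptional p q l α) :
    ∃ D : ℤ, α ^ 2 = D ∧ D % 4 = 1 ∧ ¬ IsSquare D := by
  obtain ⟨rfl, hsq, hα⟩ := h
  have hpodd : p % 2 = 1 := hp.eq_two_or_odd.resolve_left (Ne.symm hlp)
  have hk : Odd k := by
    rw [← Nat.not_even_iff_odd]
    rintro ⟨j, rfl⟩
    exact hsq ⟨p ^ j, by rw [hq, pow_add]⟩
  refine ⟨jacobiSym (-1) p * q, by rw [hα]; push_cast; rfl, ?_⟩
  have hp4 : (p : ℤ) ^ 2 ≡ 1 [ZMOD 4] := by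
    rcases (by omega : (p : ℤ) % 4 = 1 ∨ (p : ℤ) % 4 = 3) with h | h
    · exact Int.ModEq.pow 2 (show (p : ℤ) ≡ 1 [ZMOD 4] from h)
    · exact Int.ModEq.pow 2 (show (p : ℤ) ≡ 3 [ZMOD 4] from h)
  have hq4 : (q : ℤ) % 4 = (p : ℤ) % 4 := by
    obtain ⟨j, hj⟩ := hk
    have h1 := (hp4.pow j).mul_right (p : ℤ)
    rw [one_pow, one_mul, ← pow_mul, ← pow_succ, ← hj] at h1
    rw [hq]
    push_cast
    exact h1
  rw [jacobiSym.at_neg_one (Nat.odd_iff.mpr hpodd)]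
  rcases (by omega : p % 4 = 1 ∨ p % 4 = 3) with h | h
  · rw [ZMod.χ₄_nat_one_mod_four h, one_mul]
    refine ⟨by omega, ?_⟩
    rwa [Int.isSquare_natCast_iff]
  · rw [ZMod.χ₄_nat_three_mod_four h]
    refine ⟨by omega, ?_⟩
    rintro ⟨c, hc⟩
    have h0 : (0 : ℤ) < q := by
      rw [hq]
      exact_mod_cast pow_pos hp.pos k
    nlinarith [mul_self_nonneg c]

/-- The image of a generator `α` in an order `A` embedded into `ℂ`. -/
structure IsOrderGenerator {A : Type*} [CommRing A] (σ : A →+* ℂ) (α : ℂ) (θ : A) : Prop where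
  injective : Function.Injective σ
  map_eq : σ θ = α
  exists_mul_eq : ∀ r : A, ∃ (d : ℤ) (P : ℤ[X]), d ≠ 0 ∧
    (d : A) * r = P.eval₂ (Int.castRingHom A) θ

section Abstract

variable {A : Type*} [CommRing A] {σ : A →+* ℂ} {α : ℂ} {θ : A}

lemma IsOrderGenerator.exists_smul_eq (h : IsOrderGenerator σ α θ) (r : A) :
    ∃ (d : ℤ) (P : ℤ[X]), d ≠ 0 ∧ d • r = aeval θ P := by
  obtain ⟨d, P, hd, hP⟩ := h.exists_mul_eq r
  exact ⟨d, P, hd, by rw [zsmul_eq_mul, hP]; rfl⟩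

lemma IsOrderGenerator.map_aeval (h : IsOrderGenerator σ α θ) (P : ℤ[X]) :
    σ (aeval θ P) = aeval α P := by
  rw [aeval_def, aeval_def, hom_eval₂, h.map_eq]
  congr 1
  exact RingHom.ext_int _ _

variable [IsDomain A] [CharZero A] [Module.Finite ℤ A] {l : ℕ} {M : Type*} [AddCommGroup M]
  [Module (LAdic l A A) M] {e : ℕ}

lemma IsLattice.modBy_equiv_of_not_isExceptional {p k q : ℕ} (hp : p.Prime) (hk : 0 < k)
    (hq : q = p ^ k) (hα : IsSupersingularNumber q α) (hlp : l ≠ p)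
    (hex : ¬ IsExceptional p q l α) (hσ : IsOrderGenerator σ α θ)
    (hΛ : IsAdicOrder l (LAdic l A A)) (hM : IsLattice l (LAdic l A A) M e) {x : LAdic l A A}
    (hx : x = algebraMap A (LAdic l A A) (θ - 1)) :
    Nonempty (ModBy x M ≃ₗ[LAdic l A A] (Fin e → LAdic l A A ⧸ Ideal.span {x})) := by
  have hθint : IsIntegral ℤ θ := IsIntegral.of_finite ℤ θ
  have hmin : ∀ P : ℤ[X], aeval θ P = 0 → minpoly ℤ θ ∣ P :=
    fun P hP => minpoly.isIntegrallyClosed_dvd hθint hP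
  obtain ⟨hF1, hF⟩ := exists_eval_of_not_isExceptional hp hk hq hα hΛ.prime hlp
    (F := minpoly ℤ θ) (fun P hP => hmin P (hσ.injective (by rw [hσ.map_aeval, hP, map_zero]))) hex
  exact hM.modBy_sub_one_equiv hΛ ⟨minpoly.aeval ℤ θ, hmin, hσ.exists_smul_eq⟩ hF1 hF hx

/-- If (1 + θ)/2 lies in the order, the reduction is free and b = 0. Otherwise the order lies in
ℤ[θ] up to odd index, and the classification by 2-group indices applies. -/
lemma IsLattice.exists_modBy_equiv_of_sq_eq [Module (LAdic 2 A A) M] {D : ℤ} (hαD : α ^ 2 = D)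
    (hD : D % 4 = 1) (hDsq : ¬ IsSquare D) (hσ : IsOrderGenerator σ α θ)
    (hΛ : IsAdicOrder 2 (LAdic 2 A A)) (hM : IsLattice 2 (LAdic 2 A A) M e)
    {O : Type*} [AddCommGroup O] [Module (LAdic 2 A A) O] (hO : IsLattice 2 (LAdic 2 A A) O 1)
    {x : LAdic 2 A A} (hx : x = algebraMap A (LAdic 2 A A) (θ - 1))
    (hOx : ∀ m : O, ∃ m' : O, x • m = ((2 : ℕ) : LAdic 2 A A) • m') :
    ∃ a b : ℕ, a + b = e ∧ Nonempty (ModBy x M ≃ₗ[LAdic 2 A A]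
      ((Fin a → LAdic 2 A A ⧸ Ideal.span {x}) × (Fin b → ModBy x O))) := by
  have hgen := hσ.exists_smul_eq
  have hθD : θ ^ 2 = D := by
    apply hσ.injective
    rw [map_pow, hσ.map_eq, hαD, map_intCast]
  have hlin := eq_zero_of_add_mul_eq_zero hDsq hθD
  have hθgen : IsGenerator A θ _ :=
    isGenerator_quadratic (b := 0) (c := -D) (by push_cast; rw [hθD]; ring) hlin hgen
  have hD1 : D ≠ 1 := by
    rintro rfl
    exact hDsq ⟨1, by norm_num⟩
  obtain ⟨τ, hτdef⟩ : ∃ τ, τ = algebraMap A (LAdic 2 A A) θ := ⟨_, rfl⟩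
  have hτ : τ ^ 2 = D := by rw [hτdef, ← map_pow, hθD, map_intCast]
  have hxτ : x = τ - 1 := by rw [hx, hτdef, map_sub, map_one]
  have hidx : ∀ (c : ℤ) (v : ℕ) (u : ℤ), c ^ 2 - D = 2 ^ v * u → ¬ (2 : ℤ) ∣ u →
      (mulBy (LAdic 2 A A) (τ - c)).range.index = 2 ^ v := by
    intro c v u h hu
    have h1 := LAdic.index_sub hΛ hθgen (c := c) (v := v) (u := u)
      (by simpa [sub_eq_add_neg] using h) (by simpa using hu)
    rwa [map_sub, map_intCast, ← hτdef] at h1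
  obtain ⟨n, u, hn, hu⟩ := Int.exists_eq_prime_pow_mul Nat.prime_two
    (sub_ne_zero.mpr hD1.symm)
  have hn' : 1 - D = 2 ^ n * u := by simpa using hn
  have hu' : ¬ (2 : ℤ) ∣ u := by simpa using hu
  have htwo := hΛ.index_two hτ hD hidx hn' hu'
  have hxdvd : x ∣ ((2 : ℕ) : LAdic 2 A A) ^ n := by
    have h1 := LAdic.sub_dvd_pow hΛ hθgen.aeval_eq_zero (c := 1) (v := n) (u := u)
      (by simpa [sub_eq_add_neg] using hn) hu
    rwa [Int.cast_one, ← hx] at h1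
  -- An inverse of 2 in the order would make 2 a unit in the completion, of index 1 instead of 4.
  have hhalf : ∀ r : A, 2 * r ≠ 1 := by
    intro r hr
    have hr' : ((2 : ℕ) : A) * r = 1 := by rwa [Nat.cast_ofNat]
    have h1 : IsUnit ((2 : ℕ) : LAdic 2 A A) := by
      refine IsUnit.of_mul_eq_one (algebraMap A (LAdic 2 A A) r) ?_
      rw [← map_natCast (algebraMap A (LAdic 2 A A)), ← map_mul, hr', map_one]
    rw [index_range_mulBy_of_isUnit h1] at htwo
    norm_num at htwo
  rcases exists_half_or_forall_odd (by omega) hθD hhalf hgen with ⟨ω, hω⟩ | hodd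
  · have hs := hM.spannedMod_of_half hΛ hD hD1 hθD hlin hgen htwo hω
    rw [← hx] at hs
    obtain ⟨E⟩ := hM.modBy_equiv hΛ hxdvd hs
    exact ⟨e, 0, add_zero e, ⟨E.trans LinearEquiv.prodUnique.symm⟩⟩
  · have hint : ∀ a : LAdic 2 A A, ∃ (z : ℤ) (a' : LAdic 2 A A), a = z + (τ - 1) * a' := by
      rw [← hxτ, hx]
      exact LAdic.exists_eq_intCast_add (hx ▸ hxdvd) hodd
    rw [hxτ] at hOx ⊢
    exact hM.exists_modBy_equiv hΛ hO hτ hD hidx htwo hn' hu' hint hOx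

end Abstract

/-- The element (z - 1)/2 is a root of X^2 + X + (1 - D)/4. This is what makes multiplication by π -
1 on the ring of integers divisible by 2. -/
lemma isIntegral_sub_one_div_two {K : Type*} [Field K] [CharZero K] {z : K} {D : ℤ}
    (hz : z ^ 2 = D) (hD : D % 4 = 1) : IsIntegral ℤ ((z - 1) / 2) := by
  obtain ⟨ε, hε⟩ : ∃ ε : ℤ, 1 - D = 4 * ε := ⟨(1 - D) / 4, by omega⟩
  have hε' : (1 - D : K) = 4 * ε := by exact_mod_cast congrArg (Int.cast : ℤ → K) hε
  refine ⟨_, (natDegree_X_sq_add 1 ε).2, ?_⟩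
  simp only [eval₂_add, eval₂_pow, eval₂_X, eval₂_mul, eval₂_C]
  rw [map_one, eq_intCast]
  linear_combination hz / 4 - hε' / 4

lemma IsOrderGenerator.of_subalgebra {K : Type*} [Field K] [CharZero K] (R : Subalgebra ℤ K)
    (j : K →+* ℂ) {α : ℂ} (g : R) (hg : j g = α)
    (hgen : ∀ z : K, ∃ (d : ℤ) (P : ℤ[X]), d ≠ 0 ∧
      (d : K) * z = P.eval₂ (Int.castRingHom K) (g : K)) :
    IsOrderGenerator (j.comp (algebraMap R K)) α g := by
  have hinj : Function.Injective (algebraMap R K) := Subtype.val_injective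
  refine ⟨j.injective.comp hinj, hg, fun r => ?_⟩
  obtain ⟨d, P, hd, hP⟩ := hgen (algebraMap R K r)
  refine ⟨d, P, hd, hinj ?_⟩
  rw [hom_eval₂, map_mul, map_intCast, hP]
  congr 1

section Order

variable {K : Type*} [Field K] [Algebra ℚ K] [CharZero K] {R : Subalgebra ℤ K} (hR : IsOrder R)
  {j : K →+* ℂ} {α : ℂ} {g : R} {l : ℕ} {M : Type*} [AddCommGroup M] [Module (LAdic l R R) M]
  [Module.IsTorsionFree (LAdic l R R) M] {e : ℕ}

lemma HasRank.isLattice_of_isOrder (hR : IsOrder R) [Module.Finite (LAdic l R R) M]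
    (hl : l.Prime) (hM : HasRank l (LAdic l R R) M e) : IsLattice l (LAdic l R R) M e := by
  have hΛ := hR.isAdicOrder hl
  refine hM.isLattice hΛ fun m hm => ?_
  have hreg : IsRegular (l : LAdic l R R) := by
    rw [isRegular_iff_mem_nonZeroDivisors, mem_nonZeroDivisors_iff_right]
    exact fun a ha => hΛ.regular a (by rw [mul_comm, ha])
  exact hreg.isSMulRegular (by simpa using hm)

/-- The classification of `M / (g - 1) M` for a number field `K` with a complex embedding and a
generator `g` mapping to `α`. -/
theorem HasRank.modBy_sub_one_equiv {p k q : ℕ} (hp : p.Prime) (hk : 0 < k) (hq : q = p ^ k)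
    (hα : IsSupersingularNumber q α) (hl : l.Prime) (hlp : l ≠ p) [FiniteDimensional ℚ K]
    [Module.Finite (LAdic l R R) M] (hM : HasRank l (LAdic l R R) M e)
    (hg : j g = α) (hgen : ∀ z : K, ∃ (d : ℤ) (P : ℤ[X]), d ≠ 0 ∧
      (d : K) * z = P.eval₂ (Int.castRingHom K) (g : K))
    {x : LAdic l R R} (hx : x = algebraMap R (LAdic l R R) (g - 1)) :
    (¬ IsExceptional p q l α →
      Nonempty (ModBy x M ≃ₗ[LAdic l R R] (Fin e → LAdic l R R ⧸ Ideal.span {x}))) ∧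
    (IsExceptional p q l α →
      ∃ a b : ℕ, a + b = e ∧
        Nonempty (ModBy x M ≃ₗ[LAdic l R R]
          ((Fin a → LAdic l R R ⧸ Ideal.span {x}) ×
            (Fin b → ModBy x (LAdic l R (integersOver R hR)))))) := by
  have := hR.finite
  have hΛ := hR.isAdicOrder hl
  have hlat := hM.isLattice_of_isOrder hR hl
  have hσ := IsOrderGenerator.of_subalgebra R j g hg hgen
  refine ⟨fun hex => hlat.modBy_equiv_of_not_isExceptional hp hk hq hα hlp hex hσ hΛ hx,
    fun hex => ?_⟩
  obtain ⟨D, hαD, hD, hDsq⟩ := hex.properties hp hq hlp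
  obtain rfl := hex.1
  refine hlat.exists_modBy_equiv_of_sq_eq hαD hD hDsq hσ hΛ (integersOver.isLattice hR hΛ) hx
    fun m => ?_
  have hgD : (g : K) ^ 2 = (D : K) := by
    apply j.injective
    rw [map_pow, map_intCast, ← hαD, hg]
  rw [hx]
  refine integersOver.exists_smul_eq hR (isIntegral_sub_one_div_two hgD hD) ?_ m
  push_cast
  ring

end Order

end Main

theorem corollaryC58 (p k q : ℕ) (hp : p.Prime) (hk : 0 < k) (hq : q = p ^ k)
    (π : ℂ) (hπ : IsSupersingularNumber q π)
    (l : ℕ) (hl : l.Prime) (hlp : l ≠ p)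
    (R : Subalgebra ℤ ℚ⟮π⟯) (hR : IsOrder R)
    (hπR : IntermediateField.AdjoinSimple.gen ℚ π ∈ R)
    (M : Type*) [AddCommGroup M] [Module (LAdic l R R) M]
    [Module.Finite (LAdic l R R) M] [Module.IsTorsionFree (LAdic l R R) M]
    (e : ℕ) (hM : HasRank l (LAdic l R R) M e)
    (x : LAdic l R R)
    (hx : x = algebraMap R (LAdic l R R) (⟨IntermediateField.AdjoinSimple.gen ℚ π, hπR⟩ - 1)) :
    (¬ IsExceptional p q l π →
      Nonempty (ModBy x M ≃ₗ[LAdic l R R] (Fin e → LAdic l R R ⧸ Ideal.span {x}))) ∧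
    (IsExceptional p q l π →
      ∃ a b : ℕ, a + b = e ∧
        Nonempty (ModBy x M ≃ₗ[LAdic l R R]
          ((Fin a → LAdic l R R ⧸ Ideal.span {x}) ×
            (Fin b → ModBy x (LAdic l R (integersOver R hR)))))) := by
  have := hR.finite
  have hπint : IsIntegral ℚ π := by
    rw [← IntermediateField.AdjoinSimple.isIntegral_gen]
    exact ((IsIntegral.of_finite ℤ (⟨_, hπR⟩ : R)).map R.val).tower_top
  have hfd : FiniteDimensional ℚ ℚ⟮π⟯ := IntermediateField.adjoin.finiteDimensional hπint
  exact hM.modBy_sub_one_equiv hR (j := algebraMap ℚ⟮π⟯ ℂ) hp hk hq hπ hl hlp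
    (IntermediateField.AdjoinSimple.algebraMap_gen ℚ π)
    (exists_mul_eq_eval₂_gen hπint) hx
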